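/- **Distributed index coding.** There are $n$ messages $x_j\in\{0,1\}^{t_j}$, $j\in[n]$. Receiver $j$ wants $x_j$ and knows $x(A_j)$, where $A_j\subseteq[n]\setminus\{j\}$. The problem is written as the list of the $(j\mid i\in A_j)$ and identified with the directed graph on $[n]$ with an edge $i\to j$ iff $i\in A_j$; two problems are isomorphic if their graphs are. For every nonempty $J\subseteq[n]$ there is a server holding the messages in $J$, which sends to all receivers $u_J$ bits that are a function of $(x_i)_{i\in J}$. Receiver $j$ must recover $x_j$ without error from all server outputs and $x(A_j)$. For link capacities $\mathbf C=(C_J)$, $C_J\ge 0$, a rate tuple $\mathbf R=(R_j)\in\mathbb R_{\ge0}^n$ is achievable if there are a positive integer $r$ and such a code with $R_j\le t_j/r$ and $u_J/r\le C_J$ for all $j,J$. The capacity region $\mathscr C(\mathbf C)$ is the closure of the set of achievable rate tuples. **MAIS bound.** The MAIS region consists of all $\mathbf R\ge 0$ such that, for every nonempty $T\subseteq[n]$ and every $S\subseteq T$ whose induced subgraph has no directed cycle, $\sum_{j\in S}R_j\le\sum_{J:\,J\cap T\ne\emptyset}C_J$. **Distributed composite coding (same decoding sets across all servers).** Let $D_j\subseteq[n]$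 with $j\in D_j$. The inner bound with decoding sets $(D_j)$ is the closure of the set of $\mathbf R\ge 0$ for which there are $C_{K,J}\ge0$ ($\emptyset\ne K\subseteq J$) with $\sum_{K\subseteq J:\,K\not\subseteq A_j}C_{K,J}\le C_J$ for all $j$ and $J$, and, for all $j$ and all $L\subseteq D_j\setminus A_j$ with $\sum_{i\in L}R_i>0$, $$\sum_{i\in L}R_i<\sum_{K\subseteq D_j\cup A_j:\,K\cap L\ne\emptyset}\ \sum_{J:\,K\subseteq J}C_{K,J}.$$ The composite coding inner bound is defined in the same way, but with the sets $D_j\ni j$ chosen freely (given the $C_{K,J}$ and $\mathbf R$). **Theorem.** Let $n=3$, and consider the following table of problems, bounds and decoding sets. | Row | Problems | $R_1$ | $R_2$ | $R_3$ | $R_1{+}R_2$ | $R_1{+}R_3$ | $R_2{+}R_3$ | $R_1{+}R_2{+}R_3$ | $D_j$ | |---|---|---|---|---|---|---|---|---|---| | 1 | $(1);(2);(3)$, $(1\mid2);(2);(3)$, $(1\mid2,3);(2);(3)$, $(1);(2\mid3);(3\mid1)$, $(1);(2\mid1);(3\mid1)$, $(1);(2\mid1);(3\mid1,2)$ | 4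 | 4 | 4 | 6 | 6 | 6 | 7 | $[3]\setminus A_j$ | | 2 | $(1\mid3);(2\mid1);(3\mid2)$ | 4 | 4 | 4 | 6 | 6 | 6 | 9 | $[3]\setminus A_j$ | | 3 | $(1);(2\mid3);(3\mid2)$, $(1);(2\mid1,3);(3\mid2)$, $(1);(2\mid1,3);(3\mid1,2)$ | 4 | 4 | 4 | 6 | 6 | 8 | 9 | $\{j\}$ if $A_j=\emptyset$, else $[3]\setminus A_j$ | | 4 | $(1\mid3);(2\mid3);(3\mid2)$, $(1\mid3);(2\mid1,3);(3\mid2)$, $(1\mid2,3);(2\mid3);(3\mid2)$ | 4 | 4 | 4 | 6 | 6 | 8 | 10 | $[3]\setminus A_j$ | | 5 | $(1\mid3);(2\mid3);(3\mid1,2)$, $(1\mid2,3);(2\mid3);(3\mid1,2)$ | 4 | 4 | 4 | 6 | 8 | 8 | 10 | $[3]\setminus A_j$ | | 6 | $(1\mid2,3);(2\mid1,3);(3\mid1,2)$ | 4 | 4 | 4 | 8 | 8 | 8 | 12 | $[3]\setminus A_j$ | 1. Every 3-message problem is isomorphic to exactly one of the 16 problems in the table, and these are pairwise non-isomorphic.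 2. Let $C_J=1$ for all $J$. For every problem in the table, the capacity region is the set of all $\mathbf R\ge0$ for which the seven sums heading the columns are at most the numbers listed in its row; the maximal sum rate $R_1+R_2+R_3$ equals the last number listed (for example, it is $9$ for $(1\mid3);(2\mid1);(3\mid2)$ and for $(1);(2\mid3);(3\mid2)$); the listed sets satisfy $j\in D_j$; and the composite coding inner bound with these decoding sets equals the capacity region. 3. Let $C_J=1$ for all $J$. For the problems in rows 1, 2, 4, 5, 6 the capacity region equals the MAIS region. For those in row 3 it does not, but it equals the set of $\mathbf R$ in the MAIS region with $R_1+R_2+R_3\le9$. 4. For every 3-message problem and arbitrary $C_J\ge0$, the composite coding inner bound equals the capacity region. -/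

import Mathlib

namespace DistIndexCoding

/-- An index coding problem with `n` messages: receiver `j` wants message `j` and knows the
messages in `A j`, where `A j ⊆ [n] \ {j}`.  Equivalently, a directed graph on `Fin n` without
loops, with an edge `i → j` iff `i ∈ A j`. -/
structure Problem (n : ℕ) where
  A : Fin n → Finset (Fin n)
  not_mem : ∀ j, j ∉ A j

/-- Two problems are isomorphic if they agree up to a relabelling of the messages. -/
def Problem.Isomorphic {n : ℕ} (P Q : Problem n) : Prop :=
  ∃ σ : Equiv.Perm (Fin n), ∀ i j, i ∈ P.A j ↔ σ i ∈ Q.A (σ j)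

/-- The servers: one for each nonempty set `J` of messages; server `J` holds the messages in `J`. -/
abbrev Server (n : ℕ) : Type := {J : Finset (Fin n) // J.Nonempty}

/-- A (zero-error) distributed index code: message `j` has `t j` bits, server `J` broadcasts `u J`
bits that depend only on the messages in `J`, and receiver `j` recovers message `j` from its side
information and the outputs of all servers. -/
structure Code {n : ℕ} (P : Problem n) where
  t : Fin n → ℕ
  u : Server n → ℕ
  enc : (J : Server n) → ((i : {i // i ∈ J.1}) → Fin (t i.1) → Bool) → (Fin (u J) → Bool)
  dec : (j : Fin n) → ((i : {i // i ∈ P.A j}) → Fin (t i.1) → Bool) →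
    ((J : Server n) → Fin (u J) → Bool) → (Fin (t j) → Bool)
  correct : ∀ (x : (i : Fin n) → Fin (t i) → Bool) (j : Fin n),
    dec j (fun i => x i.1) (fun J => enc J (fun i => x i.1)) = x j

/-- Achievability of a rate-capacity tuple `(R, C)`, the rates being nonnegative. -/
def Achievable {n : ℕ} (P : Problem n) (R : Fin n → ℝ) (C : Server n → ℝ) : Prop :=
  (∀ j, 0 ≤ R j) ∧
    ∃ r : ℕ, 0 < r ∧ ∃ code : Code P,
      (∀ j, R j ≤ (code.t j : ℝ) / r) ∧ ∀ J, (code.u J : ℝ) / r ≤ C J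

/-- The capacity region for link capacities `C`. -/
def capacityRegion {n : ℕ} (P : Problem n) (C : Server n → ℝ) : Set (Fin n → ℝ) :=
  closure {R | Achievable P R C}

/-- The subgraph induced by the set `S` contains no directed cycle. -/
def Problem.AcyclicOn {n : ℕ} (P : Problem n) (S : Finset (Fin n)) : Prop :=
  ∀ i, ¬ Relation.TransGen (fun a b => a ∈ S ∧ b ∈ S ∧ a ∈ P.A b) i i

/-- The region cut out by the generalized maximal acyclic induced subgraph (MAIS) bound. -/
def maisRegion {n : ℕ} (P : Problem n) (C : Server n → ℝ) : Set (Fin n → ℝ) :=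
  {R | (∀ j, 0 ≤ R j) ∧
    ∀ T : Finset (Fin n), T.Nonempty → ∀ S ⊆ T, P.AcyclicOn S →
      ∑ j ∈ S, R j ≤ ∑ J : Server n with (J.1 ∩ T).Nonempty, C J}

/-- A choice `c K J` of composite coding rates, for nonempty `K ⊆ J` (other values are never used),
is admissible if for each server `J` and each receiver `j` the composite messages of `J` that are
not known to `j` beforehand fit into the link of `J`. -/
def AdmissibleRates {n : ℕ} (P : Problem n) (C : Server n → ℝ)
    (c : Finset (Fin n) → Server n → ℝ) : Prop :=
  (∀ K J, 0 ≤ c K J) ∧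
    ∀ (j : Fin n) (J : Server n), ∑ K ∈ J.1.powerset with ¬ K ⊆ P.A j, c K J ≤ C J

/-- The polymatroidal region `ℛ(D | A j)` of receiver `j` with decoding set `D`.  The constraint of
a set `L` of total rate zero (in particular of `L = ∅`) is void, as there is nothing to decode. -/
def decodingRegion {n : ℕ} (P : Problem n) (c : Finset (Fin n) → Server n → ℝ) (j : Fin n)
    (D : Finset (Fin n)) : Set (Fin n → ℝ) :=
  {R | ∀ L ⊆ D \ P.A j, 0 < ∑ i ∈ L, R i →
    ∑ i ∈ L, R i <
      ∑ K ∈ (D ∪ P.A j).powerset with (K ∩ L).Nonempty, ∑ J : Server n with K ⊆ J.1, c K J}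

/-- The rates achieved by distributed composite coding when receiver `j` uses the decoding set `D j`
across all servers. -/
def compositeRegionWith {n : ℕ} (P : Problem n) (C : Server n → ℝ)
    (D : Fin n → Finset (Fin n)) : Set (Fin n → ℝ) :=
  {R | (∀ j, 0 ≤ R j) ∧ ∃ c, AdmissibleRates P C c ∧ ∀ j, R ∈ decodingRegion P c j (D j)}

/-- The rates achieved by distributed composite coding (with the same decoding sets across all
servers), the decoding sets `D ∋ j` being free. -/
def compositeRegion {n : ℕ} (P : Problem n) (C : Server n → ℝ) : Set (Fin n → ℝ) :=
  {R | (∀ j, 0 ≤ R j) ∧ ∃ c, AdmissibleRates P C c ∧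
    ∀ j, ∃ D : Finset (Fin n), j ∈ D ∧ R ∈ decodingRegion P c j D}

/-- A row of the table of 3-message problems: a group of problems, the bounds on `R₁`, `R₂`, `R₃`,
`R₁ + R₂`, `R₁ + R₃`, `R₂ + R₃`, `R₁ + R₂ + R₃`, and the decoding set of each receiver. -/
structure Row where
  problems : List (Problem 3)
  b1 : ℕ
  b2 : ℕ
  b3 : ℕ
  b12 : ℕ
  b13 : ℕ
  b23 : ℕ
  b123 : ℕ
  D : Problem 3 → Fin 3 → Finset (Fin 3)

/-- The region listed in a row; messages 1, 2, 3 are the elements 0, 1, 2 of `Fin 3`. -/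
def Row.region (ρ : Row) : Set (Fin 3 → ℝ) :=
  {R | (∀ j, 0 ≤ R j) ∧ R 0 ≤ ρ.b1 ∧ R 1 ≤ ρ.b2 ∧ R 2 ≤ ρ.b3 ∧ R 0 + R 1 ≤ ρ.b12 ∧
    R 0 + R 2 ≤ ρ.b13 ∧ R 1 + R 2 ≤ ρ.b23 ∧ R 0 + R 1 + R 2 ≤ ρ.b123}

/-- The decoding sets `D j = [n] \ A j`. -/
def decodeAll (P : Problem 3) (j : Fin 3) : Finset (Fin 3) := Finset.univ \ P.A j

/-- The decoding sets `D j = {j}` if `A j = ∅`, and `D j = [n] \ A j` otherwise. -/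
def decodeMixed (P : Problem 3) (j : Fin 3) : Finset (Fin 3) :=
  if P.A j = ∅ then {j} else Finset.univ \ P.A j

/-- (1);(2);(3), (1|2);(2);(3), (1|2,3);(2);(3), (1);(2|3);(3|1), (1);(2|1);(3|1),
(1);(2|1);(3|1,2).  In the code, messages 1, 2, 3 are written 0, 1, 2. -/
def row1 : Row where
  problems := [⟨![∅, ∅, ∅], by decide⟩, ⟨![{1}, ∅, ∅], by decide⟩, ⟨![{1, 2}, ∅, ∅], by decide⟩,
    ⟨![∅, {2}, {0}], by decide⟩, ⟨![∅, {0}, {0}], by decide⟩, ⟨![∅, {0}, {0, 1}], by decide⟩]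
  b1 := 4
  b2 := 4
  b3 := 4
  b12 := 6
  b13 := 6
  b23 := 6
  b123 := 7
  D := decodeAll

/-- (1|3);(2|1);(3|2). -/
def row2 : Row where
  problems := [⟨![{2}, {0}, {1}], by decide⟩]
  b1 := 4
  b2 := 4
  b3 := 4
  b12 := 6
  b13 := 6
  b23 := 6
  b123 := 9
  D := decodeAll

/-- (1);(2|3);(3|2), (1);(2|1,3);(3|2), (1);(2|1,3);(3|1,2). -/
def row3 : Row where
  problems := [⟨![∅, {2}, {1}], by decide⟩, ⟨![∅, {0, 2}, {1}], by decide⟩,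
    ⟨![∅, {0, 2}, {0, 1}], by decide⟩]
  b1 := 4
  b2 := 4
  b3 := 4
  b12 := 6
  b13 := 6
  b23 := 8
  b123 := 9
  D := decodeMixed

/-- (1|3);(2|3);(3|2), (1|3);(2|1,3);(3|2), (1|2,3);(2|3);(3|2). -/
def row4 : Row where
  problems := [⟨![{2}, {2}, {1}], by decide⟩, ⟨![{2}, {0, 2}, {1}], by decide⟩,
    ⟨![{1, 2}, {2}, {1}], by decide⟩]
  b1 := 4
  b2 := 4
  b3 := 4
  b12 := 6
  b13 := 6
  b23 := 8
  b123 := 10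
  D := decodeAll

/-- (1|3);(2|3);(3|1,2), (1|2,3);(2|3);(3|1,2). -/
def row5 : Row where
  problems := [⟨![{2}, {2}, {0, 1}], by decide⟩, ⟨![{1, 2}, {2}, {0, 1}], by decide⟩]
  b1 := 4
  b2 := 4
  b3 := 4
  b12 := 6
  b13 := 8
  b23 := 8
  b123 := 10
  D := decodeAll

/-- (1|2,3);(2|1,3);(3|1,2). -/
def row6 : Row where
  problems := [⟨![{1, 2}, {0, 2}, {0, 1}], by decide⟩]
  b1 := 4
  b2 := 4
  b3 := 4
  b12 := 8
  b13 := 8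
  b23 := 8
  b123 := 12
  D := decodeAll

/-- The table of all non-isomorphic 3-message problems. -/
def table : List Row := [row1, row2, row3, row4, row5, row6]

end DistIndexCoding

open DistIndexCoding

namespace DistIndexCoding

/-! ### Converse bounds -/

/-! The converse rests on counting. Fixing the messages outside an acyclic set `S` leaves only the
servers meeting `S` informative, and acyclicity lets the messages in `S` be recovered one after
another; this is the MAIS bound. If receiver `i` knows nothing, a second count applies: from all
outputs `Y` one gets message `i`; substituting for message `k` a value determined by `Y` and
revealing the new outputs of the servers holding both `j` and `k` gives message `j`, and then `k`
follows. So the total number of message bits is at most that of all outputs plus that of the servers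
holding `j` and `k` (`Code.sum_le_of_eq_empty`).

Achievability of composite coding is a union bound over random linear maps on two levels: composite
messages are random linear functions of the messages in `K`, and each server compresses its
composites by a random matrix. Zero error holds because only finitely many nonzero differences have
to be avoided (`exists_matrices`, `exists_composite_code`).

For three messages the two sides meet. Call a problem mixed if some receiver `i` knows nothing while
the other two know each other's message. If it is not mixed, every set of messages unknown to a
single receiver is acyclic, so sending one composite of everything per server meets exactly the MAIS
constraints. If it is mixed, making receiver `i` decode all messages would limit the sum rate to the
total capacity. Instead `i` decodes only its own message, for which part of each link is left
uncoded; a suitable split exists exactly because of the MAIS bounds and the extra sum bound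
(`exists_uncoded_rates`). The table is then a finite check. -/

theorem card_bits {κ : Type*} [DecidableEq κ] (S : Finset κ) (t : κ → ℕ) :
    Fintype.card ((i : {i // i ∈ S}) → Fin (t i.1) → Bool) = 2 ^ ∑ i ∈ S, t i := by
  rw [Fintype.card_pi, ← Finset.prod_pow_eq_pow_sum, ← Finset.prod_coe_sort S fun i => 2 ^ t i]
  simp

/-- Message tuples which a receiver cannot tell apart have the same wanted message. -/
theorem Code.eq_of_enc_eq {n : ℕ} {P : Problem n} (c : Code P)
    {x y : (i : Fin n) → Fin (c.t i) → Bool} {j : Fin n} (hA : ∀ i ∈ P.A j, x i = y i)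
    (h : ∀ J, c.enc J (fun i => x i.1) = c.enc J (fun i => y i.1)) : x j = y j := by
  rw [← c.correct x j, ← c.correct y j]
  exact congrArg₂ (c.dec j) (funext fun i => hA i.1 i.2) (funext h)

theorem Code.enc_congr {n : ℕ} {P : Problem n} (c : Code P)
    {x y : (i : Fin n) → Fin (c.t i) → Bool} {J : Server n} (h : ∀ i ∈ J.1, x i = y i) :
    c.enc J (fun i => x i.1) = c.enc J (fun i => y i.1) :=
  congrArg _ (funext fun i => h i.1 i.2)

/-- Servers disjoint from `S` see no difference between `x` and `y`, so all outputs agree.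
Well-founded induction along the edges inside `S` then serves each receiver after all its side
information in `S` is known. -/
theorem Code.eq_on_of_acyclicOn {n : ℕ} {P : Problem n} (c : Code P) {S : Finset (Fin n)}
    (hS : P.AcyclicOn S) {x y : (i : Fin n) → Fin (c.t i) → Bool} (hxy : ∀ i ∉ S, x i = y i)
    (h : ∀ J : Server n, (J.1 ∩ S).Nonempty →
      c.enc J (fun i => x i.1) = c.enc J (fun i => y i.1)) (i : Fin n) : x i = y i := by
  have henc : ∀ J : Server n, c.enc J (fun i => x i.1) = c.enc J (fun i => y i.1) := by
    intro J
    by_cases hJ : (J.1 ∩ S).Nonempty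
    · exact h J hJ
    · refine c.enc_congr fun i hi => hxy i fun hiS => hJ ⟨i, Finset.mem_inter.2 ⟨hi, hiS⟩⟩
  let r := Relation.TransGen (fun a b => a ∈ S ∧ b ∈ S ∧ a ∈ P.A b)
  have : IsTrans (Fin n) r := ⟨fun _ _ _ => Relation.TransGen.trans⟩
  have : Std.Irrefl r := ⟨hS⟩
  have wf : WellFounded r := Finite.wellFounded_of_trans_of_irrefl r
  induction i using wf.induction with
  | _ j ih =>
    by_cases hj : j ∈ S
    · refine c.eq_of_enc_eq (fun i hi => ?_) henc
      by_cases hiS : i ∈ S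
      · exact ih i (Relation.TransGen.single ⟨hiS, hj, hi⟩)
      · exact hxy i hiS
    · exact hxy j hj

/-- With zeros outside `S`, the messages in `S` are an injective function of the outputs of the
servers meeting `S`. -/
theorem Code.sum_le_of_acyclicOn {n : ℕ} {P : Problem n} (c : Code P) {S : Finset (Fin n)}
    (hS : P.AcyclicOn S) :
    ∑ i ∈ S, c.t i ≤ ∑ J : Server n with (J.1 ∩ S).Nonempty, c.u J := by
  let T : Finset (Server n) := Finset.univ.filter fun J => (J.1 ∩ S).Nonempty
  let ext : ((i : {i // i ∈ S}) → Fin (c.t i.1) → Bool) → (i : Fin n) → Fin (c.t i) → Bool :=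
    fun x i => if h : i ∈ S then x ⟨i, h⟩ else fun _ => false
  let f : ((i : {i // i ∈ S}) → Fin (c.t i.1) → Bool) →
      ((J : {J // J ∈ T}) → Fin (c.u J.1) → Bool) :=
    fun x J => c.enc J.1 (fun i => ext x i.1)
  have hf : Function.Injective f := by
    intro x y hxy
    have key := c.eq_on_of_acyclicOn hS (x := ext x) (y := ext y)
      (fun i hi => by simp [ext, hi])
      (fun J hJ => congrFun hxy ⟨J, Finset.mem_filter.2 ⟨Finset.mem_univ _, hJ⟩⟩)
    funext i
    simpa [ext, i.2] using key i.1
  have := Fintype.card_le_of_injective f hf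
  rw [card_bits, card_bits] at this
  exact (Nat.pow_le_pow_iff_right (by norm_num)).1 this

theorem Achievable.capacity_nonneg {n : ℕ} {P : Problem n} {R : Fin n → ℝ} {C : Server n → ℝ}
    (h : Achievable P R C) (J : Server n) : 0 ≤ C J := by
  obtain ⟨-, r, hr, c, -, hu⟩ := h
  exact le_trans (by positivity) (hu J)

theorem Achievable.mem_maisRegion {n : ℕ} {P : Problem n} {R : Fin n → ℝ} {C : Server n → ℝ}
    (h : Achievable P R C) : R ∈ maisRegion P C := by
  refine ⟨h.1, fun T _ S hST hS => ?_⟩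
  have hC := h.capacity_nonneg
  obtain ⟨-, r, hr, c, ht, hu⟩ := h
  have h1 : ((∑ i ∈ S, c.t i : ℕ) : ℝ) ≤
      ((∑ J : Server n with (J.1 ∩ S).Nonempty, c.u J : ℕ) : ℝ) :=
    Nat.cast_le.2 (c.sum_le_of_acyclicOn hS)
  push_cast at h1
  have hr' : (0 : ℝ) < r := Nat.cast_pos.2 hr
  calc ∑ j ∈ S, R j ≤ ∑ j ∈ S, (c.t j : ℝ) / r := Finset.sum_le_sum fun j _ => ht j
    _ = (∑ j ∈ S, (c.t j : ℝ)) / r := (Finset.sum_div _ _ _).symm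
    _ ≤ (∑ J : Server n with (J.1 ∩ S).Nonempty, (c.u J : ℝ)) / r := by gcongr
    _ = ∑ J : Server n with (J.1 ∩ S).Nonempty, (c.u J : ℝ) / r := Finset.sum_div _ _ _
    _ ≤ ∑ J : Server n with (J.1 ∩ S).Nonempty, C J := Finset.sum_le_sum fun J _ => hu J
    _ ≤ ∑ J : Server n with (J.1 ∩ T).Nonempty, C J := by
      refine Finset.sum_le_sum_of_subset_of_nonneg (fun J hJ => ?_) fun J _ _ => hC J
      simp only [Finset.mem_filter, Finset.mem_univ, true_and] at hJ ⊢
      exact hJ.mono (Finset.inter_subset_inter_left hST)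

theorem isClosed_maisRegion {n : ℕ} (P : Problem n) (C : Server n → ℝ) :
    IsClosed (maisRegion P C) := by
  have : maisRegion P C = (⋂ j, {R | 0 ≤ R j}) ∩ ⋂ (T : Finset (Fin n)) (_ : T.Nonempty)
      (S : Finset (Fin n)) (_ : S ⊆ T) (_ : P.AcyclicOn S),
      {R | ∑ j ∈ S, R j ≤ ∑ J : Server n with (J.1 ∩ T).Nonempty, C J} := by
    ext R; simp [maisRegion]
  rw [this]
  refine (isClosed_iInter fun j => isClosed_le continuous_const (continuous_apply j)).inter ?_
  refine isClosed_iInter fun T => isClosed_iInter fun _ => isClosed_iInter fun S =>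
    isClosed_iInter fun _ => isClosed_iInter fun _ => isClosed_le ?_ continuous_const
  exact continuous_finsetSum _ fun j _ => continuous_apply j

theorem capacityRegion_subset_maisRegion {n : ℕ} (P : Problem n) (C : Server n → ℝ) :
    capacityRegion P C ⊆ maisRegion P C :=
  closure_minimal (fun _ h => Achievable.mem_maisRegion h) (isClosed_maisRegion P C)

/-- If receiver `i` of a 3-message problem has no side information, then the servers which hold both
other messages have to be counted at most twice. -/
theorem Code.sum_le_of_eq_empty {P : Problem 3} (c : Code P) {i j k : Fin 3} (hi : P.A i = ∅)
    (hjk : j ≠ k) (hcover : ∀ l, l = i ∨ l = j ∨ l = k) :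
    ∑ l, c.t l ≤ ∑ J, c.u J + ∑ J : Server 3 with j ∈ J.1 ∧ k ∈ J.1, c.u J := by
  classical
  let T : Finset (Server 3) := Finset.univ.filter fun J => j ∈ J.1 ∧ k ∈ J.1
  let Ω := (l : Fin 3) → Fin (c.t l) → Bool
  let Y : Ω → (J : Server 3) → Fin (c.u J) → Bool := fun x J => c.enc J (fun i => x i.1)
  let g : ((J : Server 3) → Fin (c.u J) → Bool) → Ω := Function.invFun Y
  -- All that matters about the substituted message `k` is that it is a function of the outputs `Y
  -- x`.
  let p : Ω → Ω := fun x => Function.update x k (g (Y x) k)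
  let f : Ω → ((J : Server 3) → Fin (c.u J) → Bool) ×
      ((J : {J // J ∈ T}) → Fin (c.u J.1) → Bool) :=
    fun x => (Y x, fun J => Y (p x) J.1)
  have hf : Function.Injective f := by
    intro x y hxy
    have hY : Y x = Y y := congrArg Prod.fst hxy
    have hY' : ∀ J, Y x J = Y y J := congrFun hY
    have hT : ∀ J (h : J ∈ T), Y (p x) J = Y (p y) J := fun J h =>
      congrFun (congrArg Prod.snd hxy) ⟨J, h⟩
    have hxi : x i = y i := c.eq_of_enc_eq (by simp [hi]) hY'
    have hpk : p x k = p y k := by simp [p, hY]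
    have hne : ∀ (x : Ω) (l : Fin 3), l ≠ k → p x l = x l := fun x l h => by simp [p, h]
    have hpi : p x i = p y i := by
      by_cases h : i = k
      · rw [h]; exact hpk
      · rw [hne x i h, hne y i h, hxi]
    -- Servers without `k` do not notice the substitution; those with `k` but not `j` depend only on
    -- message `i` and the substitute, both already known; those with `j` and `k` are the second
    -- component of `f`.
    have hp : ∀ J, Y (p x) J = Y (p y) J := by
      intro J
      by_cases hk : k ∈ J.1
      · by_cases hj : j ∈ J.1
        · exact hT J (Finset.mem_filter.2 ⟨Finset.mem_univ _, hj, hk⟩)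
        · refine c.enc_congr fun l hl => ?_
          rcases hcover l with rfl | rfl | rfl
          · exact hpi
          · exact absurd hl hj
          · exact hpk
      · have h : ∀ x : Ω, Y (p x) J = Y x J := fun x =>
          c.enc_congr fun l hl => hne x l fun h => hk (h ▸ hl)
        rw [h x, h y, hY]
    have hxj : x j = y j := by
      rw [← hne x j hjk, ← hne y j hjk]
      refine c.eq_of_enc_eq (fun l hl => ?_) hp
      rcases hcover l with rfl | rfl | rfl
      · exact hpi
      · exact absurd hl (P.not_mem _)
      · exact hpk
    have hxk : x k = y k := by
      refine c.eq_of_enc_eq (fun l hl => ?_) hY'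
      rcases hcover l with rfl | rfl | rfl
      · exact hxi
      · exact hxj
      · exact absurd hl (P.not_mem _)
    funext l
    rcases hcover l with rfl | rfl | rfl
    exacts [hxi, hxj, hxk]
  have := Fintype.card_le_of_injective f hf
  rw [Fintype.card_prod, card_bits] at this
  simp only [Ω, Fintype.card_pi, Fintype.card_bool, Finset.prod_const, Finset.card_univ,
    Fintype.card_fin, Finset.prod_pow_eq_pow_sum, ← pow_add] at this
  exact (Nat.pow_le_pow_iff_right (by norm_num)).1 this

theorem Achievable.sum_le_of_eq_empty {P : Problem 3} {R : Fin 3 → ℝ} {C : Server 3 → ℝ}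
    (h : Achievable P R C) {i j k : Fin 3} (hi : P.A i = ∅) (hjk : j ≠ k)
    (hcover : ∀ l, l = i ∨ l = j ∨ l = k) :
    ∑ l, R l ≤ ∑ J, C J + ∑ J : Server 3 with j ∈ J.1 ∧ k ∈ J.1, C J := by
  obtain ⟨-, r, hr, c, ht, hu⟩ := h
  have h1 := (Nat.cast_le (α := ℝ)).2 (c.sum_le_of_eq_empty hi hjk hcover)
  push_cast at h1
  have hr' : (0 : ℝ) < r := Nat.cast_pos.2 hr
  calc ∑ l, R l ≤ ∑ l, (c.t l : ℝ) / r := Finset.sum_le_sum fun j _ => ht j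
    _ = (∑ l, (c.t l : ℝ)) / r := (Finset.sum_div _ _ _).symm
    _ ≤ (∑ J, (c.u J : ℝ) + ∑ J : Server 3 with j ∈ J.1 ∧ k ∈ J.1, (c.u J : ℝ)) / r := by gcongr
    _ = ∑ J, (c.u J : ℝ) / r + ∑ J : Server 3 with j ∈ J.1 ∧ k ∈ J.1, (c.u J : ℝ) / r := by
      rw [add_div, Finset.sum_div, Finset.sum_div]
    _ ≤ _ := add_le_add (Finset.sum_le_sum fun J _ => hu J) (Finset.sum_le_sum fun J _ => hu J)

theorem sum_le_of_mem_capacityRegion {P : Problem 3} {R : Fin 3 → ℝ} {C : Server 3 → ℝ}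
    (h : R ∈ capacityRegion P C) {i j k : Fin 3} (hi : P.A i = ∅) (hjk : j ≠ k)
    (hcover : ∀ l, l = i ∨ l = j ∨ l = k) :
    ∑ l, R l ≤ ∑ J, C J + ∑ J : Server 3 with j ∈ J.1 ∧ k ∈ J.1, C J :=
  closure_minimal (t := {R : Fin 3 → ℝ |
      ∑ l, R l ≤ ∑ J, C J + ∑ J : Server 3 with j ∈ J.1 ∧ k ∈ J.1, C J})
    (fun _ h => Achievable.sum_le_of_eq_empty h hi hjk hcover)
    (isClosed_le (continuous_finsetSum _ fun j _ => continuous_apply j) continuous_const) h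

/-! ### Random linear codes -/

/-- Among all tuples of matrices `M a` over the field with two elements, a random one satisfies
`M a *ᵥ v a = 0` for all `a` with probability `2⁻¹ ^ ∑ s a`, the sum being over the `a` with
`v a ≠ 0`. -/
theorem card_matrices_eq {ι γ : Type*} [Fintype ι] [DecidableEq ι] [Fintype γ] [DecidableEq γ]
    (s : ι → ℕ) (v : ι → γ → ZMod 2) :
    ((Finset.univ.filter fun M : (a : ι) → Matrix (Fin (s a)) γ (ZMod 2) =>
        ∀ a, (M a).mulVec (v a) = 0).card : ℝ) =
      Fintype.card ((a : ι) → Matrix (Fin (s a)) γ (ZMod 2)) *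
        2⁻¹ ^ ∑ a with v a ≠ 0, s a := by
  classical
  let A : Finset ι := Finset.univ.filter fun a => v a ≠ 0
  let φ : ((a : ι) → Matrix (Fin (s a)) γ (ZMod 2)) →+
      ((a : {a // a ∈ A}) → Fin (s a.1) → ZMod 2) :=
    { toFun := fun M a => (M a.1).mulVec (v a.1)
      map_zero' := by ext; simp
      map_add' := fun M N => by ext; simp [Matrix.add_mulVec] }
  have hφ : Function.Surjective φ := by
    intro w
    have hv : ∀ a : {a // a ∈ A}, ∃ b, v a.1 b ≠ 0 := fun a => by
      by_contra! h
      exact (Finset.mem_filter.1 a.2).2 (funext h)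
    choose b hb using hv
    -- The prescribed value `w` goes into one column where `v a` is nonzero, divided by that entry.
    refine ⟨fun a => Matrix.of fun r c => if h : a ∈ A then
      (if c = b ⟨a, h⟩ then w ⟨a, h⟩ r * (v a c)⁻¹ else 0) else 0, ?_⟩
    funext a r
    have ha : a.1 ∈ A := a.2
    simp only [φ, AddMonoidHom.coe_mk, ZeroHom.coe_mk, Matrix.mulVec, dotProduct, Matrix.of_apply,
      dif_pos ha, ite_mul, zero_mul, Finset.sum_ite_eq', Finset.mem_univ, if_true]
    rw [mul_assoc, inv_mul_cancel₀ (hb a), mul_one]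
  have hker : ∀ M, M ∈ φ.ker ↔ ∀ a, (M a).mulVec (v a) = 0 := by
    intro M
    rw [AddMonoidHom.mem_ker]
    constructor
    · intro h a
      by_cases ha : v a = 0
      · rw [ha, Matrix.mulVec_zero]
      · exact congrFun h ⟨a, Finset.mem_filter.2 ⟨Finset.mem_univ _, ha⟩⟩
    · intro h
      funext a
      exact h a.1
  have h1 := φ.ker.card_mul_index
  rw [AddSubgroup.index_ker, AddMonoidHom.range_eq_top.2 hφ, AddSubgroup.card_top,
    Nat.card_eq_fintype_card (α := (a : {a // a ∈ A}) → Fin (s a.1) → ZMod 2),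
    Nat.card_eq_fintype_card (α := (a : ι) → Matrix (Fin (s a)) γ (ZMod 2))] at h1
  have h2 : Fintype.card ((a : {a // a ∈ A}) → Fin (s a.1) → ZMod 2) = 2 ^ ∑ a ∈ A, s a := by
    rw [Fintype.card_pi, ← Finset.prod_pow_eq_pow_sum, ← Finset.prod_coe_sort A fun i => 2 ^ s i]
    simp
  have h3 : (Finset.univ.filter fun M : (a : ι) → Matrix (Fin (s a)) γ (ZMod 2) =>
        ∀ a, (M a).mulVec (v a) = 0).card = Nat.card φ.ker := by
    rw [Nat.card_eq_fintype_card, Fintype.card_subtype]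
    simp only [hker]
  rw [h3, ← h1, h2]
  push_cast
  rw [mul_assoc, ← mul_pow]
  norm_num

/-- Union bound: the left-hand sum is the expected number of `x ∈ B` annihilated at every `a`. Being
below one, it is zero for some choice of matrices. -/
theorem exists_matrices {ι γ β : Type*} [Fintype ι] [Fintype γ] (s : ι → ℕ) (B : Finset β)
    (v : β → ι → γ → ZMod 2) (h : ∑ x ∈ B, (2⁻¹ : ℝ) ^ ∑ a with v x a ≠ 0, s a < 1) :
    ∃ M : (a : ι) → Matrix (Fin (s a)) γ (ZMod 2),
      ∀ x ∈ B, ∃ a, (M a).mulVec (v x a) ≠ 0 := by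
  classical
  by_contra! hM
  let G := (a : ι) → Matrix (Fin (s a)) γ (ZMod 2)
  have h1 : (Finset.univ : Finset G) ⊆
      B.biUnion fun x => Finset.univ.filter fun M => ∀ a, (M a).mulVec (v x a) = 0 := by
    intro M _
    obtain ⟨x, hx, hx'⟩ := hM M
    exact Finset.mem_biUnion.2 ⟨x, hx, Finset.mem_filter.2 ⟨Finset.mem_univ _, hx'⟩⟩
  have h2 := (Nat.cast_le (α := ℝ)).2 ((Finset.card_le_card h1).trans Finset.card_biUnion_le)
  rw [Nat.cast_sum, Finset.sum_congr rfl fun x _ => card_matrices_eq s (v x), ← Finset.mul_sum,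
    Finset.card_univ] at h2
  have h3 : (0 : ℝ) < Fintype.card G := Nat.cast_pos.2 Fintype.card_pos
  refine absurd h2 (not_le.2 ?_)
  convert mul_lt_mul_of_pos_left h h3 using 1
  rw [mul_one]

theorem card_supported_le {κ : Type*} [Fintype κ] [DecidableEq κ] (t : κ → ℕ) (L : Finset κ) :
    (Finset.univ.filter fun d : (Σ i, Fin (t i)) → ZMod 2 => ∀ p, p.1 ∉ L → d p = 0).card ≤
      2 ^ ∑ i ∈ L, t i := by
  have h2 : Fintype.card ((a : {a // a ∈ L}) → Fin (t a.1) → ZMod 2) = 2 ^ ∑ a ∈ L, t a := by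
    rw [Fintype.card_pi, ← Finset.prod_pow_eq_pow_sum, ← Finset.prod_coe_sort L fun i => 2 ^ t i]
    simp
  rw [← h2, ← Finset.card_univ]
  refine Finset.card_le_card_of_injOn
    (fun d (a : {a // a ∈ L}) b => d ⟨a.1, b⟩) (fun _ _ => Finset.mem_univ _) ?_
  intro d hd e he hde
  simp only [Finset.coe_filter, Finset.mem_univ, true_and, Set.mem_ofPred_eq] at hd he
  funext ⟨i, b⟩
  by_cases hi : i ∈ L
  · exact congrFun (congrFun hde ⟨i, hi⟩) b
  · rw [hd ⟨i, b⟩ hi, he ⟨i, b⟩ hi]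

/-- The messages on which a tuple of messages is not zero. -/
def support {κ : Type*} [Fintype κ] {t : κ → ℕ} (d : (Σ i, Fin (t i)) → ZMod 2) : Finset κ :=
  open Classical in Finset.univ.filter fun i => ∃ b, d ⟨i, b⟩ ≠ 0

theorem mem_support {κ : Type*} [Fintype κ] {t : κ → ℕ} {d : (Σ i, Fin (t i)) → ZMod 2} {i : κ} :
    i ∈ support d ↔ ∃ b, d ⟨i, b⟩ ≠ 0 := by
  simp [support]

theorem support_nonempty {κ : Type*} [Fintype κ] {t : κ → ℕ} {d : (Σ i, Fin (t i)) → ZMod 2}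
    (hd : d ≠ 0) : (support d).Nonempty := by
  obtain ⟨⟨i, b⟩, h⟩ := Function.ne_iff.1 hd
  exact ⟨i, mem_support.2 ⟨b, h⟩⟩

/-- At most `2 ^ ∑ i ∈ L, t i` vectors have support `L`, so each of the `2 ^ Fintype.card κ`
supports contributes at most one. -/
theorem sum_support_le {κ : Type*} [Fintype κ] [DecidableEq κ] (t : κ → ℕ) :
    ∑ d : (Σ i, Fin (t i)) → ZMod 2, (2⁻¹ : ℝ) ^ ∑ i ∈ support d, t i ≤
      2 ^ Fintype.card κ := by
  rw [← Finset.sum_fiberwise Finset.univ (fun d => support d)]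
  have : ∀ L : Finset κ, ∑ d : (Σ i, Fin (t i)) → ZMod 2 with support d = L,
      (2⁻¹ : ℝ) ^ ∑ i ∈ support d, t i ≤ 1 := by
    intro L
    rw [Finset.sum_congr rfl fun d hd => by rw [(Finset.mem_filter.1 hd).2], Finset.sum_const,
      nsmul_eq_mul]
    have h1 : (Finset.univ.filter fun d : (Σ i, Fin (t i)) → ZMod 2 => support d = L).card ≤
        2 ^ ∑ i ∈ L, t i := by
      refine (Finset.card_le_card fun d hd => ?_).trans (card_supported_le t L)
      simp only [Finset.mem_filter, Finset.mem_univ, true_and] at hd ⊢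
      rintro ⟨i, b⟩ hi
      by_contra h
      exact hi (hd ▸ mem_support.2 ⟨b, h⟩)
    calc _ ≤ (2 : ℝ) ^ (∑ i ∈ L, t i) * 2⁻¹ ^ ∑ i ∈ L, t i := by
          gcongr
          exact_mod_cast h1
      _ = 1 := by rw [← mul_pow]; norm_num
  refine (Finset.sum_le_sum fun L _ => this L).trans ?_
  simp

/-! ### Composite codes of finite length -/

/-- The decoder picks any message tuple consistent with what it sees; the default value never occurs
for genuine inputs. -/
theorem exists_code_of_injective {n : ℕ} {P : Problem n} (t : Fin n → ℕ) (u : Server n → ℕ)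
    (enc : (J : Server n) → ((i : {i // i ∈ J.1}) → Fin (t i.1) → Bool) → (Fin (u J) → Bool))
    (h : ∀ j (x y : (i : Fin n) → Fin (t i) → Bool), (∀ i ∈ P.A j, x i = y i) →
      (∀ J, enc J (fun i => x i.1) = enc J (fun i => y i.1)) → x j = y j) :
    ∃ c : Code P, c.t = t ∧ c.u = u := by
  classical
  let consistent (j : Fin n) (a : (i : {i // i ∈ P.A j}) → Fin (t i.1) → Bool)
      (b : (J : Server n) → Fin (u J) → Bool) (x : (i : Fin n) → Fin (t i) → Bool) : Prop :=
    (fun i : {i // i ∈ P.A j} => x i.1) = a ∧ (fun J => enc J (fun i => x i.1)) = b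
  refine ⟨⟨t, u, enc, fun j a b =>
    if hx : ∃ x, consistent j a b x then hx.choose j else fun _ => false, fun x j => ?_⟩, rfl, rfl⟩
  have hx : ∃ y, consistent j (fun i => x i.1) (fun J => enc J (fun i => x i.1)) y :=
    ⟨x, rfl, rfl⟩
  rw [dif_pos hx]
  obtain ⟨h1, h2⟩ := hx.choose_spec
  exact h j _ x (fun i hi => congrFun h1 ⟨i, hi⟩) (congrFun h2)

/-- A linear index code for receivers `j` which know everything but the messages in `E j`. -/
theorem exists_compression {κ : Type*} [Fintype κ] {n : ℕ} (s : κ → ℕ)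
    (E : Fin n → Finset κ) (u : ℕ)
    (hu : (∀ j, ∑ k ∈ E j, s k = 0) ∨ ∀ j, ∑ k ∈ E j, s k + n ≤ u) :
    ∃ N : Matrix (Fin u) (Σ k, Fin (s k)) (ZMod 2), ∀ j (d : (Σ k, Fin (s k)) → ZMod 2),
      (∀ p, p.1 ∉ E j → d p = 0) → N.mulVec d = 0 → d = 0 := by
  classical
  -- The first alternative serves links of capacity zero, where the `n` spare bits are not
  -- available.
  rcases hu with hu | hu
  · refine ⟨0, fun j d hd _ => funext fun p => ?_⟩
    by_cases hp : p.1 ∈ E j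
    · have h0 : s p.1 = 0 := Finset.sum_eq_zero_iff.1 (hu j) _ hp
      exact absurd p.2.2 (by omega)
    · exact hd p hp
  let X (j : Fin n) : Finset ((Σ k, Fin (s k)) → ZMod 2) :=
    Finset.univ.filter fun d => ∀ p, p.1 ∉ E j → d p = 0
  let B : Finset (Σ _ : Fin n, (Σ k, Fin (s k)) → ZMod 2) :=
    Finset.univ.sigma fun j => (X j).filter fun d => d ≠ 0
  -- Each of the `n` receivers fails with probability at most `2⁻¹ ^ n`, by its `n` spare bits, and
  -- `n < 2 ^ n`.
  obtain ⟨M, hM⟩ := exists_matrices (fun _ : Unit => u) B (fun x _ => x.2) (by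
    calc ∑ x ∈ B, (2⁻¹ : ℝ) ^ ∑ a : Unit with x.2 ≠ 0, u
        = ∑ x ∈ B, (2⁻¹ : ℝ) ^ u := Finset.sum_congr rfl fun x hx => by
          have : x.2 ≠ 0 := (Finset.mem_filter.1 (Finset.mem_sigma.1 hx).2).2
          simp [this]
      _ = ∑ j, ∑ d ∈ X j with d ≠ 0, (2⁻¹ : ℝ) ^ u := Finset.sum_sigma _ _ _
      _ ≤ ∑ j : Fin n, (2⁻¹ : ℝ) ^ n := Finset.sum_le_sum fun j _ => by
          rw [Finset.sum_const, nsmul_eq_mul]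
          have h1 : ((X j).filter fun d => d ≠ 0).card ≤ 2 ^ ∑ k ∈ E j, s k :=
            (Finset.card_filter_le _ _).trans (card_supported_le s (E j))
          calc _ ≤ (2 : ℝ) ^ (∑ k ∈ E j, s k) * 2⁻¹ ^ (∑ k ∈ E j, s k + n) := by
                gcongr ?_ * ?_
                · exact_mod_cast h1
                · exact pow_le_pow_of_le_one (by norm_num) (by norm_num) (hu j)
            _ = 2⁻¹ ^ n := by
                rw [pow_add, ← mul_assoc, ← mul_pow]; norm_num
      _ = n * 2⁻¹ ^ n := by simp
      _ < 2 ^ n * 2⁻¹ ^ n := by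
          gcongr
          exact_mod_cast n.lt_two_pow_self
      _ = 1 := by rw [← mul_pow]; norm_num)
  refine ⟨M (), fun j d hd h => ?_⟩
  by_contra hne
  obtain ⟨a, ha⟩ := hM ⟨j, d⟩ (Finset.mem_sigma.2 ⟨Finset.mem_univ _, Finset.mem_filter.2
    ⟨Finset.mem_filter.2 ⟨Finset.mem_univ _, hd⟩, hne⟩⟩)
  exact ha h

/-- The messages in `K`, the others being replaced by zero. -/
def mask {κ : Type*} [DecidableEq κ] {t : κ → ℕ} (K : Finset κ) (d : (Σ i, Fin (t i)) → ZMod 2) :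
    (Σ i, Fin (t i)) → ZMod 2 :=
  fun p => if p.1 ∈ K then d p else 0

theorem mask_sub {κ : Type*} [DecidableEq κ] {t : κ → ℕ} (K : Finset κ)
    (d e : (Σ i, Fin (t i)) → ZMod 2) : mask K (d - e) = mask K d - mask K e := by
  funext p
  by_cases h : p.1 ∈ K <;> simp [mask, h]

/-- Linear composite messages which allow receiver `j` to recover the messages in `G j`, if it knows
the composite messages indexed by `H j`. -/
theorem exists_composite_messages {n : ℕ} {ι : Type*} [Fintype ι] (t : Fin n → ℕ)
    (s : Finset (Fin n) → ι → ℕ) (G : Fin n → Finset (Fin n))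
    (H : Fin n → Finset (Finset (Fin n)))
    (hs : ∀ j, ∀ L ⊆ G j, L.Nonempty → (∀ i ∈ L, 0 < t i) →
      ∑ i ∈ L, t i + 2 * n ≤ ∑ K ∈ H j with (K ∩ L).Nonempty, ∑ J, s K J) :
    ∃ M : (a : Finset (Fin n) × ι) → Matrix (Fin (s a.1 a.2)) (Σ i, Fin (t i)) (ZMod 2),
      ∀ j (d : (Σ i, Fin (t i)) → ZMod 2), (∀ p, p.1 ∉ G j → d p = 0) →
        (∀ K ∈ H j, ∀ J, (M (K, J)).mulVec (mask K d) = 0) → d = 0 := by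
  classical
  let X (j : Fin n) : Finset ((Σ i, Fin (t i)) → ZMod 2) :=
    Finset.univ.filter fun d => d ≠ 0 ∧ ∀ p, p.1 ∉ G j → d p = 0
  let B : Finset (Σ _ : Fin n, (Σ i, Fin (t i)) → ZMod 2) := Finset.univ.sigma X
  let v (x : Σ _ : Fin n, (Σ i, Fin (t i)) → ZMod 2) (a : Finset (Fin n) × ι) :=
    if a.1 ∈ H x.1 then mask a.1 x.2 else 0
  have key : ∀ j, ∀ d ∈ X j, ∑ i ∈ support d, t i + 2 * n ≤
      ∑ a with v ⟨j, d⟩ a ≠ 0, s a.1 a.2 := by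
    intro j d hd
    obtain ⟨-, hne, hd⟩ := Finset.mem_filter.1 hd
    refine (hs j (support d) (fun i hi => ?_) (support_nonempty hne) fun i hi => ?_).trans ?_
    · obtain ⟨b, hb⟩ := mem_support.1 hi
      by_contra h
      exact hb (hd ⟨i, b⟩ h)
    · obtain ⟨b, -⟩ := mem_support.1 hi
      exact lt_of_le_of_lt (Nat.zero_le _) b.2
    · rw [← Finset.sum_product' _ _ s]
      refine Finset.sum_le_sum_of_subset fun a ha => ?_
      obtain ⟨h1, ⟨i, hi⟩⟩ := Finset.mem_filter.1 (Finset.mem_product.1 ha).1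
      obtain ⟨hi1, hi2⟩ := Finset.mem_inter.1 hi
      obtain ⟨b, hb⟩ := mem_support.1 hi2
      refine Finset.mem_filter.2 ⟨Finset.mem_univ _, fun h0 => hb ?_⟩
      have := congrFun h0 ⟨i, b⟩
      simpa [v, h1, mask, hi1] using this
  -- Of the margin `2 * n`, one `n` pays for the `2 ^ n` possible supports and the other for the `n`
  -- receivers.
  obtain ⟨M, hM⟩ := exists_matrices (fun a : Finset (Fin n) × ι => s a.1 a.2) B v (by
    calc ∑ x ∈ B, (2⁻¹ : ℝ) ^ ∑ a with v x a ≠ 0, s a.1 a.2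
        = ∑ j, ∑ d ∈ X j, (2⁻¹ : ℝ) ^ ∑ a with v ⟨j, d⟩ a ≠ 0, s a.1 a.2 := Finset.sum_sigma _ _ _
      _ ≤ ∑ j : Fin n, 2⁻¹ ^ n := Finset.sum_le_sum fun j _ => by
          calc _ ≤ ∑ d ∈ X j, (2⁻¹ : ℝ) ^ (∑ i ∈ support d, t i + 2 * n) :=
                Finset.sum_le_sum fun d hd =>
                  pow_le_pow_of_le_one (by norm_num) (by norm_num) (key j d hd)
            _ ≤ ∑ d, (2⁻¹ : ℝ) ^ (∑ i ∈ support d, t i + 2 * n) :=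
                Finset.sum_le_sum_of_subset_of_nonneg (Finset.subset_univ _)
                  fun _ _ _ => by positivity
            _ = (∑ d : (Σ i, Fin (t i)) → ZMod 2, (2⁻¹ : ℝ) ^ (∑ i ∈ support d, t i)) *
                  2⁻¹ ^ (2 * n) := by
                rw [Finset.sum_mul]; exact Finset.sum_congr rfl fun _ _ => pow_add _ _ _
            _ ≤ 2 ^ n * 2⁻¹ ^ (2 * n) := by
                gcongr
                simpa using sum_support_le t
            _ = 2⁻¹ ^ n := by
                rw [two_mul, pow_add, ← mul_assoc, ← mul_pow]; norm_num
      _ = n * 2⁻¹ ^ n := by simp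
      _ < 2 ^ n * 2⁻¹ ^ n := by
          gcongr
          exact_mod_cast n.lt_two_pow_self
      _ = 1 := by rw [← mul_pow]; norm_num)
  refine ⟨M, fun j d hd h => ?_⟩
  by_contra hne
  obtain ⟨a, ha⟩ := hM ⟨j, d⟩ (Finset.mem_sigma.2 ⟨Finset.mem_univ _, Finset.mem_filter.2
    ⟨Finset.mem_univ _, hne, hd⟩⟩)
  by_cases hK : a.1 ∈ H j
  · exact ha (by simpa [v, hK] using h a.1 hK a.2)
  · exact ha (by simp [v, hK])

/-- By linearity it suffices to study a difference `z` vanishing on `P.A j`. The composites with `K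
⊆ P.A j` vanish on it, so equal outputs force all composites to vanish by the compression property;
those with `K ⊆ D j ∪ P.A j` then force `z` to vanish on `D j \ P.A j`, which contains `j`. -/
theorem exists_composite_code {n : ℕ} (P : Problem n) (D : Fin n → Finset (Fin n))
    (hD : ∀ j, j ∈ D j) (t : Fin n → ℕ) (s : Finset (Fin n) → Server n → ℕ) (u : Server n → ℕ)
    (hsub : ∀ K J, ¬ K ⊆ J.1 → s K J = 0)
    (hu : ∀ J, (∀ j, ∑ K ∈ J.1.powerset with ¬ K ⊆ P.A j, s K J = 0) ∨
      ∀ j, ∑ K ∈ J.1.powerset with ¬ K ⊆ P.A j, s K J + n ≤ u J)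
    (hs : ∀ j, ∀ L ⊆ D j \ P.A j, L.Nonempty → (∀ i ∈ L, 0 < t i) →
      ∑ i ∈ L, t i + 2 * n ≤
        ∑ K ∈ (D j ∪ P.A j).powerset with (K ∩ L).Nonempty, ∑ J, s K J) :
    ∃ c : Code P, c.t = t ∧ c.u = u := by
  classical
  obtain ⟨M, hM⟩ := exists_composite_messages t s (fun j => D j \ P.A j)
    (fun j => (D j ∪ P.A j).powerset) hs
  choose N hN using fun J => exists_compression (fun K => s K J)
    (fun j => J.1.powerset.filter fun K => ¬ K ⊆ P.A j) (u J) (hu J)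
  let e : ZMod 2 ≃ Bool := finTwoEquiv
  let W (J : Server n) (z : (Σ i, Fin (t i)) → ZMod 2) : (Σ K, Fin (s K J)) → ZMod 2 :=
    fun q => (M (q.1, J)).mulVec (mask q.1 z) q.2
  let ext (J : Server n) (x : (i : {i // i ∈ J.1}) → Fin (t i.1) → Bool) :
      (Σ i, Fin (t i)) → ZMod 2 :=
    fun p => if h : p.1 ∈ J.1 then e.symm (x ⟨p.1, h⟩ p.2) else 0
  let vec (x : (i : Fin n) → Fin (t i) → Bool) : (Σ i, Fin (t i)) → ZMod 2 :=
    fun p => e.symm (x p.1 p.2)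
  have hq : ∀ J (q : Σ K, Fin (s K J)), q.1 ⊆ J.1 := fun J q => by
    by_contra h
    have h1 := q.2.2
    have h2 := hsub _ _ h
    omega
  have hext : ∀ J x, W J (ext J fun i => x i.1) = W J (vec x) := by
    intro J x
    funext q
    have : mask q.1 (ext J fun i => x i.1) = mask q.1 (vec x) := by
      funext p
      by_cases hp : p.1 ∈ q.1
      · simp [mask, hp, ext, vec, hq J q hp]
      · simp [mask, hp]
    simp only [W, this]
  have hWsub : ∀ J z z', W J (z - z') = W J z - W J z' := by
    intro J z z'
    funext q
    simp [W, mask_sub, Matrix.mulVec_sub]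
  refine exists_code_of_injective t u
    (fun J x r => e ((N J).mulVec (W J (ext J x)) r)) fun j x y hxy henc => ?_
  let z := vec x - vec y
  have hz : ∀ p, p.1 ∈ P.A j → z p = 0 := fun p hp => by
    simp [z, vec, hxy p.1 hp]
  have hW : ∀ J, W J z = 0 := by
    intro J
    refine hN J j _ (fun q hq' => ?_) ?_
    · have hqA : q.1 ⊆ P.A j := by
        by_contra h
        exact hq' (Finset.mem_filter.2 ⟨Finset.mem_powerset.2 (hq J q), h⟩)
      have : mask q.1 z = 0 := by
        funext p
        by_cases hp : p.1 ∈ q.1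
        · simp [mask, hp, hz p (hqA hp)]
        · simp [mask, hp]
      simp [W, this]
    · rw [hWsub, Matrix.mulVec_sub, sub_eq_zero, ← hext J x, ← hext J y]
      funext r
      exact e.injective (congrFun (henc J) r)
  have hd := hM j (mask (D j \ P.A j) z) (fun p hp => by simp [mask, hp]) fun K hK J => by
    -- Inside `D j ∪ P.A j` the inner mask only removes entries in `P.A j`, where `z` is zero
    -- already.
    have : mask K (mask (D j \ P.A j) z) = mask K z := by
      funext p
      by_cases hp : p.1 ∈ K
      · rcases Finset.mem_union.1 (Finset.mem_powerset.1 hK hp) with h | h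
        · by_cases h' : p.1 ∈ P.A j
          · simp [mask, hz p h']
          · simp [mask, h, h']
        · simp [mask, hz p h]
      · simp [mask, hp]
    rw [this]
    funext r
    exact congrFun (hW J) ⟨K, r⟩
  funext b
  have := congrFun hd ⟨j, b⟩
  simp only [mask, Finset.mem_sdiff, hD j, P.not_mem j, not_false_eq_true, and_self, if_true,
    Pi.zero_apply] at this
  exact e.symm.injective (sub_eq_zero.1 this)

/-! ### Achievability of composite coding -/

open Filter Topology in
-- Rounding down costs less than one bit per composite, at most `N` in all, while the strict gap
-- grows linearly in `m`.
theorem eventually_floor_sum_le {n : ℕ} {R : Fin n → ℝ} (hR : ∀ j, 0 ≤ R j)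
    (c : Finset (Fin n) → Server n → ℝ) (L : Finset (Fin n)) (H : Finset (Finset (Fin n))) (d : ℕ)
    (h : ∑ i ∈ L, R i < ∑ K ∈ H, ∑ J : Server n with K ⊆ J.1, c K J) :
    ∀ᶠ m : ℕ in atTop, ∑ i ∈ L, ⌊m * R i⌋₊ + d ≤
      ∑ K ∈ H, ∑ J : Server n, if K ⊆ J.1 then ⌊m * c K J⌋₊ else 0 := by
  set x := ∑ i ∈ L, R i
  set y := ∑ K ∈ H, ∑ J : Server n with K ⊆ J.1, c K J with hy
  let N : ℝ := ∑ K ∈ H, ∑ J : Server n with K ⊆ J.1, 1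
  filter_upwards [eventually_ge_atTop ⌈(d + N) / (y - x)⌉₊] with m hm
  have hm' : d + N ≤ m * (y - x) := by
    rw [← div_le_iff₀ (sub_pos.2 h)]
    exact (Nat.le_ceil _).trans (Nat.cast_le.2 hm)
  simp only [← Finset.sum_filter]
  rw [← Nat.cast_le (α := ℝ)]
  push_cast
  calc ∑ i ∈ L, (⌊m * R i⌋₊ : ℝ) + d ≤ ∑ i ∈ L, m * R i + d := by
        gcongr with i
        exact Nat.floor_le (mul_nonneg (Nat.cast_nonneg _) (hR i))
    _ = m * x + d := by rw [← Finset.mul_sum]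
    _ ≤ m * y - N := by linarith
    _ = ∑ K ∈ H, ∑ J : Server n with K ⊆ J.1, (m * c K J - 1) := by
        simp only [hy, N, Finset.sum_sub_distrib, Finset.mul_sum]
    _ ≤ _ := Finset.sum_le_sum fun K _ => Finset.sum_le_sum fun J _ =>
        (Nat.sub_one_lt_floor _).le

open Filter Topology in
-- Codes for message sizes `⌊m * R j⌋₊` are used at block length `m + a`. The constant `a` supplies
-- the `n` spare bits on every link of positive capacity and does not affect the limiting rates.
theorem compositeRegion_subset_capacityRegion {n : ℕ} (P : Problem n) {C : Server n → ℝ}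
    (hC : ∀ J, 0 ≤ C J) : compositeRegion P C ⊆ capacityRegion P C := by
  rintro R ⟨hR, c, ⟨hc0, hc⟩, hD⟩
  choose D hjD hdec using hD
  obtain ⟨a, ha⟩ : ∃ a : ℕ, ∀ J, 0 < C J → (n : ℝ) ≤ a * C J := by
    refine ⟨∑ J, ⌈n / C J⌉₊, fun J hJ => ?_⟩
    rw [← div_le_iff₀ hJ]
    refine (Nat.le_ceil _).trans (Nat.cast_le.2 ?_)
    exact Finset.single_le_sum (f := fun J => ⌈n / C J⌉₊) (fun _ _ => Nat.zero_le _)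
      (Finset.mem_univ J)
  let t (m : ℕ) (j : Fin n) : ℕ := ⌊m * R j⌋₊
  let s (m : ℕ) (K : Finset (Fin n)) (J : Server n) : ℕ := if K ⊆ J.1 then ⌊m * c K J⌋₊ else 0
  let u (m : ℕ) (J : Server n) : ℕ := ⌊(m + a) * C J⌋₊
  have hsum : ∀ m J j, ((∑ K ∈ J.1.powerset with ¬ K ⊆ P.A j, s m K J : ℕ) : ℝ) ≤ m * C J := by
    intro m J j
    push_cast
    refine le_trans (Finset.sum_le_sum fun K hK => ?_)
      ((Finset.mul_sum _ _ _).symm.le.trans (mul_le_mul_of_nonneg_left (hc j J) m.cast_nonneg))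
    have hKJ : K ⊆ J.1 := Finset.mem_powerset.1 (Finset.mem_filter.1 hK).1
    simp only [s, if_pos hKJ]
    exact Nat.floor_le (mul_nonneg m.cast_nonneg (hc0 K J))
  have hu : ∀ m J, (∀ j, ∑ K ∈ J.1.powerset with ¬ K ⊆ P.A j, s m K J = 0) ∨
      ∀ j, ∑ K ∈ J.1.powerset with ¬ K ⊆ P.A j, s m K J + n ≤ u m J := by
    intro m J
    rcases (hC J).eq_or_lt with h | h
    · left
      intro j
      have := hsum m J j
      rw [← h, mul_zero] at this
      exact Nat.le_zero.1 (by exact_mod_cast this)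
    · right
      intro j
      refine Nat.le_floor ?_
      push_cast
      have := hsum m J j
      push_cast at this
      linarith [ha J h]
  have hev : ∀ᶠ m : ℕ in atTop, ∀ j, ∀ L : Finset (Fin n), L ⊆ D j \ P.A j → 0 < ∑ i ∈ L, R i →
      ∑ i ∈ L, t m i + 2 * n ≤
        ∑ K ∈ (D j ∪ P.A j).powerset with (K ∩ L).Nonempty, ∑ J, s m K J := by
    refine eventually_all.2 fun j => eventually_all.2 fun L => ?_
    by_cases h : L ⊆ D j \ P.A j ∧ 0 < ∑ i ∈ L, R i
    · filter_upwards [eventually_floor_sum_le hR c L _ (2 * n) (hdec j L h.1 h.2)] with m hm _ _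
      exact hm
    · exact Eventually.of_forall fun m h1 h2 => absurd ⟨h1, h2⟩ h
  refine mem_closure_of_tendsto (b := atTop)
    (f := fun (m : ℕ) j => (t m j : ℝ) / ((m + a : ℕ) : ℝ)) ?_ ?_
  · rw [tendsto_pi_nhds]
    intro j
    have h1 := (tendsto_nat_floor_mul_div_atTop (hR j)).comp (tendsto_natCast_atTop_atTop (R := ℝ))
    have h2 := tendsto_natCast_div_add_atTop (𝕜 := ℝ) (a : ℝ)
    have h3 := h1.mul h2
    rw [mul_one] at h3
    refine h3.congr' ?_
    filter_upwards [eventually_gt_atTop 0] with m hm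
    have : (m : ℝ) ≠ 0 := Nat.cast_ne_zero.2 hm.ne'
    simp only [Function.comp, t, Nat.cast_add, mul_comm (R j)]
    field_simp
  · filter_upwards [hev, eventually_gt_atTop 0] with m hm hm0
    obtain ⟨code, hct, hcu⟩ := exists_composite_code P D hjD (t m) (s m) (u m)
      (fun K J h => if_neg h) (hu m) fun j L hL hne hpos => hm j L hL <| by
        -- A message with at least one bit has positive rate, so the void constraints on sets of
        -- rate zero are never needed.
        refine Finset.sum_pos (fun i hi => ?_) hne
        refine (hR i).lt_of_ne fun h0 => ?_
        have := hpos i hi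
        simp [t, ← h0] at this
    have hr : (0 : ℝ) < ((m + a : ℕ) : ℝ) := by positivity
    refine ⟨fun j => by positivity, m + a, by omega, code, fun j => by rw [hct], fun J => ?_⟩
    rw [hcu, div_le_iff₀ hr, mul_comm]
    push_cast
    exact Nat.floor_le (mul_nonneg (by positivity) (hC J))

theorem compositeRegionWith_subset_compositeRegion {n : ℕ} {P : Problem n} {C : Server n → ℝ}
    {D : Fin n → Finset (Fin n)} (hD : ∀ j, j ∈ D j) :
    compositeRegionWith P C D ⊆ compositeRegion P C :=
  fun _ ⟨hR, c, hc, h⟩ => ⟨hR, c, hc, fun j => ⟨D j, hD j, h j⟩⟩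

theorem closure_compositeRegionWith_eq {n : ℕ} {P : Problem n} {C : Server n → ℝ}
    {D : Fin n → Finset (Fin n)} (hC : ∀ J, 0 ≤ C J) (hD : ∀ j, j ∈ D j)
    (h : capacityRegion P C ⊆ closure (compositeRegionWith P C D)) :
    closure (compositeRegionWith P C D) = capacityRegion P C ∧
      closure (compositeRegion P C) = capacityRegion P C := by
  have h1 := closure_mono (compositeRegionWith_subset_compositeRegion (P := P) (C := C) hD)
  have h2 : closure (compositeRegion P C) ⊆ capacityRegion P C :=
    closure_minimal (compositeRegion_subset_capacityRegion P hC) isClosed_closure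
  exact ⟨(h1.trans h2).antisymm h, h2.antisymm (h.trans h1)⟩

/-! ### Composite rates for the servers -/

open Filter Topology in
/-- The strict inequalities in the definition of the polymatroidal regions may be relaxed. -/
theorem mem_closure_compositeRegionWith {n : ℕ} {P : Problem n} {C : Server n → ℝ}
    {D : Fin n → Finset (Fin n)} {R : Fin n → ℝ} (hR : ∀ j, 0 ≤ R j)
    {c : Finset (Fin n) → Server n → ℝ} (hc : AdmissibleRates P C c)
    (h : ∀ j, ∀ L ⊆ D j \ P.A j, ∑ i ∈ L, R i ≤
      ∑ K ∈ (D j ∪ P.A j).powerset with (K ∩ L).Nonempty, ∑ J : Server n with K ⊆ J.1, c K J) :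
    R ∈ closure (compositeRegionWith P C D) := by
  -- Scaling by `m / (m + 1)` makes every constraint of positive rate strict; the others are void.
  refine mem_closure_of_tendsto (b := atTop)
    (f := fun (m : ℕ) j => ((m : ℝ) / (m + 1)) * R j) ?_ (Eventually.of_forall fun m => ?_)
  · rw [tendsto_pi_nhds]
    intro j
    simpa using (tendsto_natCast_div_add_atTop (𝕜 := ℝ) 1).mul_const (R j)
  · have h1 : (m : ℝ) / (m + 1) < 1 := (div_lt_one (by positivity)).2 (by linarith)
    refine ⟨fun j => mul_nonneg (by positivity) (hR j), c, hc, fun j L hL hpos => ?_⟩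
    rw [← Finset.mul_sum] at hpos ⊢
    have h0 : 0 < ∑ i ∈ L, R i := pos_of_mul_pos_right hpos (by positivity)
    exact (mul_lt_of_lt_one_left h0 h1).trans_le (h j L hL)

/-- Server `J` uses rate `b J` of its link for message `i` alone and the rest for the composite
message of all its messages. -/
def splitRates {n : ℕ} (C b : Server n → ℝ) (i : Fin n) (K : Finset (Fin n)) (J : Server n) : ℝ :=
  (if K = J.1 then C J - b J else 0) + if K = {i} then b J else 0

theorem admissibleRates_splitRates {n : ℕ} (P : Problem n) {C b : Server n → ℝ} (i : Fin n)
    (hb : ∀ J, 0 ≤ b J) (hbC : ∀ J, b J ≤ C J) : AdmissibleRates P C (splitRates C b i) := by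
  have h0 : ∀ K J, 0 ≤ splitRates C b i K J := fun K J => by
    have := hb J
    have := hbC J
    unfold splitRates
    split_ifs <;> linarith
  refine ⟨h0, fun j J => ?_⟩
  calc _ ≤ ∑ K, splitRates C b i K J :=
        Finset.sum_le_sum_of_subset_of_nonneg (Finset.subset_univ _) fun _ _ _ => h0 _ _
    _ = C J := by simp [splitRates, Finset.sum_add_distrib]

/-- Since `b J = 0` whenever `i ∉ J`, the condition `K ⊆ J` discards nothing from the uncoded part.
-/
theorem sum_splitRates {n : ℕ} {C b : Server n → ℝ} {i : Fin n} (hi : ∀ J, i ∉ J.1 → b J = 0)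
    (H : Finset (Finset (Fin n))) :
    ∑ K ∈ H, ∑ J : Server n with K ⊆ J.1, splitRates C b i K J =
      ∑ J : Server n with J.1 ∈ H, (C J - b J) + if {i} ∈ H then ∑ J, b J else 0 := by
  simp only [Finset.sum_filter]
  rw [Finset.sum_comm]
  have : ∀ J : Server n, ∑ K ∈ H, (if K ⊆ J.1 then splitRates C b i K J else 0) =
      (if J.1 ∈ H then C J - b J else 0) + if {i} ∈ H then b J else 0 := by
    intro J
    have h1 : ∀ K, (if K ⊆ J.1 then splitRates C b i K J else 0) =
        (if K = J.1 then C J - b J else 0) + if K = {i} then b J else 0 := by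
      intro K
      unfold splitRates
      by_cases hK : K ⊆ J.1
      · rw [if_pos hK]
      · have h2 : K ≠ J.1 := fun h => hK h.subset
        rw [if_neg hK, if_neg h2, zero_add]
        split_ifs with h3
        · exact (hi J fun h => hK (by simpa [h3] using h)).symm
        · rfl
    simp only [h1, Finset.sum_add_distrib, Finset.sum_ite_eq']
  simp only [this, Finset.sum_add_distrib]
  split_ifs <;> simp

/-- When `i` is among the unknowns, both parts of each link help, so splitting loses nothing. -/
theorem sum_le_sum_splitRates_of_mem {n : ℕ} {C b : Server n → ℝ} {i : Fin n}
    (hb : ∀ J, 0 ≤ b J) (hi : ∀ J, i ∉ J.1 → b J = 0) {D L : Finset (Fin n)}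
    (hD : D = Finset.univ) (hL : i ∈ L) :
    ∑ J : Server n with (J.1 ∩ L).Nonempty, C J ≤
      ∑ K ∈ D.powerset with (K ∩ L).Nonempty, ∑ J : Server n with K ⊆ J.1,
        splitRates C b i K J := by
  subst hD
  have h1 : ({i} ∩ L).Nonempty := ⟨i, by simp [hL]⟩
  rw [sum_splitRates hi]
  simp only [Finset.powerset_univ, Finset.mem_filter, Finset.mem_univ, true_and, h1, if_true,
    Finset.sum_sub_distrib]
  have : ∑ J : Server n with (J.1 ∩ L).Nonempty, b J ≤ ∑ J, b J :=
    Finset.sum_le_sum_of_subset_of_nonneg (Finset.subset_univ _) fun _ _ _ => hb _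
  linarith

/-- Intended for `i ∉ L`, where the uncoded parts are of no use and only the remainders `C J - b J`
count. -/
theorem sum_le_sum_splitRates {n : ℕ} {C b : Server n → ℝ} {i : Fin n}
    (hb : ∀ J, 0 ≤ b J) (hi : ∀ J, i ∉ J.1 → b J = 0) {D : Finset (Fin n)}
    (hD : D = Finset.univ) (L : Finset (Fin n)) :
    ∑ J : Server n with (J.1 ∩ L).Nonempty, (C J - b J) ≤
      ∑ K ∈ D.powerset with (K ∩ L).Nonempty, ∑ J : Server n with K ⊆ J.1,
        splitRates C b i K J := by
  subst hD
  rw [sum_splitRates hi]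
  simp only [Finset.powerset_univ, Finset.mem_filter, Finset.mem_univ, true_and]
  refine le_add_of_nonneg_right ?_
  split_ifs
  exacts [Finset.sum_nonneg fun J _ => hb J, le_rfl]

/-! ### Three messages -/

theorem Problem.acyclicOn_of_rank {n : ℕ} {P : Problem n} {S : Finset (Fin n)} (f : Fin n → ℕ)
    (hf : ∀ a ∈ S, ∀ b ∈ S, a ∈ P.A b → f a < f b) : P.AcyclicOn S := by
  have : ∀ a b, Relation.TransGen (fun a b => a ∈ S ∧ b ∈ S ∧ a ∈ P.A b) a b → f a < f b := by
    intro a b h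
    induction h with
    | single h => exact hf _ h.1 _ h.2.1 h.2.2
    | tail _ h ih => exact ih.trans (hf _ h.1 _ h.2.1 h.2.2)
  exact fun i h => (this i i h).false

theorem Problem.not_acyclicOn {n : ℕ} {P : Problem n} {S : Finset (Fin n)} {a b : Fin n}
    (ha : a ∈ S) (hb : b ∈ S) (hab : a ∈ P.A b) (hba : b ∈ P.A a) : ¬ P.AcyclicOn S :=
  fun h => h a ((Relation.TransGen.single ⟨ha, hb, hab⟩).tail ⟨hb, ha, hba⟩)

theorem sum_le_of_mem_maisRegion {n : ℕ} {P : Problem n} {C : Server n → ℝ} {R : Fin n → ℝ}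
    (hR : R ∈ maisRegion P C) {S : Finset (Fin n)} (hS : P.AcyclicOn S) :
    ∑ j ∈ S, R j ≤ ∑ J : Server n with (J.1 ∩ S).Nonempty, C J := by
  rcases S.eq_empty_or_nonempty with rfl | h
  · simp
  · exact hR.2 S h S subset_rfl hS

theorem eq_or_eq_add_one_or_eq_add_two : ∀ i l : Fin 3, l = i ∨ l = i + 1 ∨ l = i + 2 := by
  decide

/-- The 3-message problems in which receiver `i` knows nothing and the other two receivers know each
other's message. -/
def Problem.IsMixed (P : Problem 3) (i : Fin 3) : Prop :=
  P.A i = ∅ ∧ i + 1 ∈ P.A (i + 2) ∧ i + 2 ∈ P.A (i + 1)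

/-- No edge inside `L` leaves `j`'s side information, hence none enters `j`. A cycle would have to
be a 2-cycle on the other two receivers, both unknown to `j`, which is the mixed case. The rank puts
`j` first and orders the other two along the surviving edge. -/
theorem Problem.acyclicOn_of_not_isMixed {P : Problem 3} {j : Fin 3} (hP : ¬ P.IsMixed j)
    {L : Finset (Fin 3)} (hL : L ⊆ Finset.univ \ P.A j) : P.AcyclicOn L := by
  have hL' : ∀ a ∈ L, a ∉ P.A j := fun a ha => (Finset.mem_sdiff.1 (hL ha)).2
  have hself := P.not_mem
  by_cases h : j + 1 ∈ P.A (j + 2)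
  · refine acyclicOn_of_rank (fun l => if l = j then 0 else if l = j + 1 then 1 else 2)
      fun a ha b hb hab => ?_
    have hP' : j + 1 ∈ L → j + 2 ∈ L → j + 2 ∉ P.A (j + 1) := fun h1 h2 h3 => by
      refine hP ⟨Finset.eq_empty_of_forall_notMem fun l hl => ?_, h, h3⟩
      have := eq_or_eq_add_one_or_eq_add_two j l
      rcases this with rfl | rfl | rfl
      exacts [hself _ hl, hL' _ h1 hl, hL' _ h2 hl]
    have hja := hL' a ha
    have hab' : a ≠ b := fun h => hself b (h ▸ hab)
    fin_cases j <;> fin_cases a <;> fin_cases b <;> simp_all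
  · refine acyclicOn_of_rank (fun l => if l = j then 0 else if l = j + 1 then 2 else 1)
      fun a ha b hb hab => ?_
    have hja := hL' a ha
    have hab' : a ≠ b := fun h => hself b (h ▸ hab)
    fin_cases j <;> fin_cases a <;> fin_cases b <;> simp_all

/-- With `b = 0` each server sends a single composite of all its messages, and the decoding
constraint of `L` becomes the MAIS inequality of `L`. -/
theorem mem_closure_of_not_isMixed {P : Problem 3} (hP : ∀ i, ¬ P.IsMixed i) {C : Server 3 → ℝ}
    (hC : ∀ J, 0 ≤ C J) {R : Fin 3 → ℝ} (hR : R ∈ maisRegion P C) :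
    R ∈ closure (compositeRegionWith P C (decodeAll P)) := by
  refine mem_closure_compositeRegionWith hR.1
    (admissibleRates_splitRates P (b := 0) 0 (fun _ => le_rfl) hC) fun j L hL => ?_
  have hD : decodeAll P j ∪ P.A j = Finset.univ :=
    Finset.sdiff_union_of_subset (Finset.subset_univ _)
  have hL' : L ⊆ Finset.univ \ P.A j :=
    hL.trans (Finset.sdiff_subset_sdiff (Finset.subset_univ _) subset_rfl)
  refine (sum_le_of_mem_maisRegion hR (Problem.acyclicOn_of_not_isMixed (hP j) hL')).trans ?_
  simpa using
    sum_le_sum_splitRates (C := C) (b := 0) (i := 0) (fun _ => le_rfl) (fun _ _ => rfl) hD L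

theorem sum_server_three (f : Server 3 → ℝ) (i : Fin 3) :
    ∑ J, f J = f ⟨{i}, by simp⟩ + f ⟨{i + 1}, by simp⟩ + f ⟨{i + 2}, by simp⟩ +
      f ⟨{i, i + 1}, by simp⟩ + f ⟨{i, i + 2}, by simp⟩ + f ⟨{i + 1, i + 2}, by simp⟩ +
      f ⟨{i, i + 1, i + 2}, by simp⟩ := by
  have h1 : ∀ i : Fin 3, (Finset.univ : Finset (Server 3)).val =
      ({⟨{i}, by simp⟩, ⟨{i + 1}, by simp⟩, ⟨{i + 2}, by simp⟩, ⟨{i, i + 1}, by simp⟩,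
        ⟨{i, i + 2}, by simp⟩, ⟨{i + 1, i + 2}, by simp⟩, ⟨{i, i + 1, i + 2}, by simp⟩} :
        Multiset (Server 3)) := by decide +kernel
  rw [Finset.sum, h1 i]
  simp [add_assoc]

/-- The part of the links of the servers holding message `i` which is to be used for message `i`
alone when the other two receivers know each other's message. -/
theorem exists_uncoded_rates {C : Server 3 → ℝ} (hC : ∀ J, 0 ≤ C J) {R : Fin 3 → ℝ} (i : Fin 3)
    (hi : R i ≤ ∑ J : Server 3 with (J.1 ∩ {i}).Nonempty, C J)
    (hj : R (i + 1) ≤ ∑ J : Server 3 with (J.1 ∩ {i + 1}).Nonempty, C J)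
    (hk : R (i + 2) ≤ ∑ J : Server 3 with (J.1 ∩ {i + 2}).Nonempty, C J)
    (hij : R i + R (i + 1) ≤ ∑ J : Server 3 with (J.1 ∩ {i, i + 1}).Nonempty, C J)
    (hik : R i + R (i + 2) ≤ ∑ J : Server 3 with (J.1 ∩ {i, i + 2}).Nonempty, C J)
    (hijk : R i + R (i + 1) + R (i + 2) ≤
      ∑ J, C J + ∑ J : Server 3 with i + 1 ∈ J.1 ∧ i + 2 ∈ J.1, C J) :
    ∃ b : Server 3 → ℝ, (∀ J, 0 ≤ b J) ∧ (∀ J, b J ≤ C J) ∧ (∀ J, i ∉ J.1 → b J = 0) ∧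
      b ⟨{i}, by simp⟩ = 0 ∧ R i ≤ C ⟨{i}, by simp⟩ + ∑ J, b J ∧
      R (i + 1) ≤ ∑ J : Server 3 with (J.1 ∩ {i + 1}).Nonempty, (C J - b J) ∧
      R (i + 2) ≤ ∑ J : Server 3 with (J.1 ∩ {i + 2}).Nonempty, (C J - b J) := by
  have e1 : i ≠ i + 1 := (by decide : ∀ i : Fin 3, i ≠ i + 1) i
  have e2 : i ≠ i + 2 := (by decide : ∀ i : Fin 3, i ≠ i + 2) i
  have e3 : i + 1 ≠ i + 2 := (by decide : ∀ i : Fin 3, i + 1 ≠ i + 2) i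
  have hmem : ∀ (J : Finset (Fin 3)) l, (J ∩ {l}).Nonempty ↔ l ∈ J := fun J l => by
    simp [Finset.Nonempty]
  have hmem2 : ∀ (J : Finset (Fin 3)) l m, (J ∩ {l, m}).Nonempty ↔ l ∈ J ∨ m ∈ J := by
    intro J l m
    simp only [Finset.Nonempty, Finset.mem_inter, Finset.mem_insert, Finset.mem_singleton]
    aesop
  simp only [hmem, hmem2, Finset.sum_filter, sum_server_three _ i, Finset.mem_insert,
    Finset.mem_singleton, e1, e2, e3, e1.symm, e2.symm, e3.symm, or_true, or_false, and_true,
    and_false, or_self, and_self, if_true, if_false,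
    add_zero, zero_add] at hi hj hk hij hik hijk ⊢
  set C1 := C ⟨{i}, by simp⟩ with h1
  set C2 := C ⟨{i + 1}, by simp⟩ with h2
  set C3 := C ⟨{i + 2}, by simp⟩ with h3
  set C12 := C ⟨{i, i + 1}, by simp⟩ with h12
  set C13 := C ⟨{i, i + 2}, by simp⟩ with h13
  set C23 := C ⟨{i + 1, i + 2}, by simp⟩ with h23
  set C123 := C ⟨{i, i + 1, i + 2}, by simp⟩ with h123
  have hC12 : 0 ≤ C12 := hC _
  have hC13 : 0 ≤ C13 := hC _
  have hC123 : 0 ≤ C123 := hC _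
  -- `w1`, `w2`, `w3` are the uncoded rates of the servers `{i, i + 1}`, `{i, i + 2}` and `{i, i +
  -- 1, i + 2}`.
  obtain ⟨w1, w2, w3, p1, p2, p3, q1, q2, q3, s1, s2, s3⟩ : ∃ w1 w2 w3 : ℝ,
      0 ≤ w1 ∧ 0 ≤ w2 ∧ 0 ≤ w3 ∧ w1 ≤ C12 ∧ w2 ≤ C13 ∧ w3 ≤ C123 ∧
      R i ≤ C1 + (w1 + w2 + w3) ∧ R (i + 1) + (w1 + w3) ≤ C2 + C12 + C23 + C123 ∧
      R (i + 2) + (w2 + w3) ≤ C3 + C13 + C23 + C123 := by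
    -- `p` and `q` are the slacks of receivers `i + 1` and `i + 2`, bounding `w1 + w3` and `w2 +
    -- w3`. The choice is greedy: `w1` and `w2` burden one receiver each and are filled first, `w3`
    -- burdens both. The total is then `p + q`, `p + C13`, `C12 + q` or `C12 + C13 + C123`, and the
    -- bound on `R i` is respectively `hijk`, `hij`, `hik` or `hi`.
    let p := C2 + C12 + C23 + C123 - R (i + 1)
    let q := C3 + C13 + C23 + C123 - R (i + 2)
    rcases le_total p C12 with hp | hp <;> rcases le_total q C13 with hq | hq
    · exact ⟨p, q, 0, by grind⟩
    · exact ⟨p, C13, 0, by grind⟩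
    · exact ⟨C12, q, 0, by grind⟩
    · rcases le_total (p - C12) (q - C13) with hpq | hpq
      · rcases le_total C123 (p - C12) with h | h
        · exact ⟨C12, C13, C123, by grind⟩
        · exact ⟨C12, C13, p - C12, by grind⟩
      · rcases le_total C123 (q - C13) with h | h
        · exact ⟨C12, C13, C123, by grind⟩
        · exact ⟨C12, C13, q - C13, by grind⟩
  refine ⟨fun J => if i ∈ J.1 then if i + 1 ∈ J.1 then if i + 2 ∈ J.1 then w3 else w1 else
    if i + 2 ∈ J.1 then w2 else 0 else 0, fun J => ?_, fun J => ?_, fun J hJ => if_neg hJ, ?_⟩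
  · dsimp only
    split_ifs <;> first | assumption | exact le_rfl
  · have hset : ∀ (i : Fin 3) (J : Finset (Fin 3)), i ∈ J →
        J = if i + 1 ∈ J then if i + 2 ∈ J then {i, i + 1, i + 2} else {i, i + 1} else
          if i + 2 ∈ J then {i, i + 2} else {i} := by decide +kernel
    obtain ⟨J, hJ⟩ := J
    dsimp only
    split_ifs with g1 g2 g3 g3
    · have := hset i J g1
      rw [if_pos g2, if_pos g3] at this
      subst this
      exact q3
    · have := hset i J g1
      rw [if_pos g2, if_neg g3] at this
      subst this
      exact q1
    · have := hset i J g1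
      rw [if_neg g2, if_pos g3] at this
      subst this
      exact q2
    · exact hC _
    · exact hC _
  · simp only [Finset.mem_insert, Finset.mem_singleton, e1, e2, e3, e1.symm, e2.symm, e3.symm,
      or_true, or_false, or_self, if_true, if_false, add_zero, zero_add]
    refine ⟨trivial, ?_, ?_, ?_⟩ <;> linarith

theorem self_mem_decodeAll (P : Problem 3) (j : Fin 3) : j ∈ decodeAll P j :=
  Finset.mem_sdiff.2 ⟨Finset.mem_univ _, P.not_mem j⟩

theorem self_mem_decodeMixed (P : Problem 3) (j : Fin 3) : j ∈ decodeMixed P j := by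
  unfold decodeMixed
  split_ifs
  exacts [Finset.mem_singleton_self j, self_mem_decodeAll P j]

/-- For a problem in which receiver `i` knows nothing and the other two receivers know each other's
message, the sum rate bound is to be added to the MAIS bound. -/
def mixedRegion (P : Problem 3) (C : Server 3 → ℝ) (i : Fin 3) : Set (Fin 3 → ℝ) :=
  maisRegion P C ∩ {R | R i + R (i + 1) + R (i + 2) ≤
    ∑ J, C J + ∑ J : Server 3 with i + 1 ∈ J.1 ∧ i + 2 ∈ J.1, C J}

theorem add_add_eq_sum (R : Fin 3 → ℝ) (i : Fin 3) : R i + R (i + 1) + R (i + 2) = ∑ l, R l := by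
  rw [Fin.sum_univ_three]
  fin_cases i
  · rfl
  · change R 1 + R 2 + R 0 = _
    ring
  · change R 2 + R 0 + R 1 = _
    ring

/-- Receiver `i` uses the server `{i}` and the uncoded parts. Each other receiver knows one message
and decodes two: sets containing `i` are covered by the MAIS bound, as `{i, j}` is acyclic when `P.A
i = ∅`, and `{j}` alone by the choice of `b`. -/
theorem mem_closure_of_isMixed {P : Problem 3} {i : Fin 3} (hP : P.IsMixed i) {C : Server 3 → ℝ}
    (hC : ∀ J, 0 ≤ C J) {R : Fin 3 → ℝ} (hR : R ∈ mixedRegion P C i) :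
    R ∈ closure (compositeRegionWith P C (decodeMixed P)) := by
  obtain ⟨hR, hsum⟩ := hR
  obtain ⟨hA, hjk, hkj⟩ := hP
  have e1 : i ≠ i + 1 := (by decide : ∀ i : Fin 3, i ≠ i + 1) i
  have e2 : i ≠ i + 2 := (by decide : ∀ i : Fin 3, i ≠ i + 2) i
  have hac : ∀ m, P.AcyclicOn {i, m} := fun m =>
    Problem.acyclicOn_of_rank (fun l => if l = i then 0 else 1) fun a ha b hb hab => by
      have hbi : b ≠ i := by
        rintro rfl
        simp [hA] at hab
      have hbm : b = m := by simpa [hbi] using hb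
      have hai : a = i := by
        refine (by simpa using ha : a = i ∨ a = m).resolve_right ?_
        rintro rfl
        exact P.not_mem a (hbm ▸ hab)
      simp [hai, hbi]
  have hac1 : ∀ m, P.AcyclicOn {m} := fun m =>
    Problem.acyclicOn_of_rank (fun _ => 0) fun a ha b hb hab => by
      rw [Finset.mem_singleton.1 ha, Finset.mem_singleton.1 hb] at hab
      exact absurd hab (P.not_mem m)
  have hmais := fun S => sum_le_of_mem_maisRegion (S := S) hR
  obtain ⟨b, hb, hbC, hbi, hb0, hRi, hRj, hRk⟩ := exists_uncoded_rates hC i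
    (by simpa using hmais _ (hac1 i)) (by simpa using hmais _ (hac1 (i + 1)))
    (by simpa using hmais _ (hac1 (i + 2)))
    (by simpa [Finset.sum_pair e1] using hmais _ (hac (i + 1)))
    (by simpa [Finset.sum_pair e2] using hmais _ (hac (i + 2))) hsum
  refine mem_closure_compositeRegionWith hR.1 (admissibleRates_splitRates P i hb hbC) ?_
  have other : ∀ j m, j ≠ i → m ∈ P.A j → (∀ l, l = i ∨ l = j ∨ l = m) →
      R j ≤ ∑ J : Server 3 with (J.1 ∩ {j}).Nonempty, (C J - b J) →
      ∀ L ⊆ decodeMixed P j \ P.A j, ∑ l ∈ L, R l ≤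
        ∑ K ∈ (decodeMixed P j ∪ P.A j).powerset with (K ∩ L).Nonempty,
          ∑ J : Server 3 with K ⊆ J.1, splitRates C b i K J := by
    intro j m hj hm hcover hRj L hL
    have hD : decodeMixed P j ∪ P.A j = Finset.univ := by
      rw [decodeMixed, if_neg (Finset.ne_empty_of_mem hm)]
      exact Finset.sdiff_union_of_subset (Finset.subset_univ _)
    have hLm : m ∉ L := fun h => (Finset.mem_sdiff.1 (hL h)).2 hm
    have hLsub : L ⊆ {i, j} := fun l hl => by
      rcases hcover l with rfl | rfl | rfl
      exacts [by simp, by simp, absurd hl hLm]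
    by_cases hiL : i ∈ L
    · refine (hmais L ?_).trans (sum_le_sum_splitRates_of_mem hb hbi hD hiL)
      by_cases hjL : j ∈ L
      · have : L = {i, j} := hLsub.antisymm (by simp [Finset.insert_subset_iff, hiL, hjL])
        exact this ▸ hac j
      · have : L = {i} := by
          refine Finset.Subset.antisymm (fun l hl => ?_) (by simpa using hiL)
          have := hLsub hl
          simp only [Finset.mem_insert, Finset.mem_singleton] at this ⊢
          exact this.resolve_right fun h => hjL (h ▸ hl)
        exact this ▸ hac1 i
    · refine le_trans ?_ (sum_le_sum_splitRates hb hbi hD L)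
      by_cases hjL : j ∈ L
      · have : L = {j} := by
          refine Finset.Subset.antisymm (fun l hl => ?_) (by simpa using hjL)
          have := hLsub hl
          simp only [Finset.mem_insert, Finset.mem_singleton] at this ⊢
          exact this.resolve_left fun h => hiL (h ▸ hl)
        rw [this, Finset.sum_singleton]
        exact hRj
      · have : L = ∅ := Finset.eq_empty_of_forall_notMem fun l hl => by
          rcases hcover l with rfl | rfl | rfl
          exacts [hiL hl, hjL hl, hLm hl]
        simp [this]
  intro j
  rcases eq_or_eq_add_one_or_eq_add_two i j with rfl | rfl | rfl
  · intro L hL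
    simp only [decodeMixed, hA, if_true, Finset.sdiff_empty, Finset.union_empty] at hL ⊢
    rcases Finset.subset_singleton_iff.1 hL with rfl | rfl
    · simp
    · rw [Finset.sum_singleton, sum_splitRates hbi, if_pos (by simp)]
      refine hRi.trans (add_le_add_left ?_ _)
      have := Finset.single_le_sum (s := Finset.univ.filter fun J : Server 3 =>
          J.1 ∈ (Finset.powerset {j}).filter fun K => (K ∩ {j}).Nonempty)
        (f := fun J => C J - b J) (fun J _ => sub_nonneg.2 (hbC J)) (a := ⟨{j}, by simp⟩) (by simp)
      simpa [hb0] using this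
  · exact other _ _ e1.symm hkj (eq_or_eq_add_one_or_eq_add_two i) hRj
  · exact other _ _ e2.symm hjk
      (fun l => (eq_or_eq_add_one_or_eq_add_two i l).imp_right Or.symm) hRk

theorem capacityRegion_of_not_isMixed {P : Problem 3} (hP : ∀ i, ¬ P.IsMixed i)
    {C : Server 3 → ℝ} (hC : ∀ J, 0 ≤ C J) :
    capacityRegion P C = maisRegion P C ∧
      closure (compositeRegionWith P C (decodeAll P)) = capacityRegion P C ∧
      closure (compositeRegion P C) = capacityRegion P C := by
  have h := closure_compositeRegionWith_eq hC (self_mem_decodeAll P) fun R hR =>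
    mem_closure_of_not_isMixed hP hC (capacityRegion_subset_maisRegion P C hR)
  exact ⟨(capacityRegion_subset_maisRegion P C).antisymm
    fun R hR => h.1.subset (mem_closure_of_not_isMixed hP hC hR), h⟩

theorem capacityRegion_of_isMixed {P : Problem 3} {i : Fin 3} (hP : P.IsMixed i)
    {C : Server 3 → ℝ} (hC : ∀ J, 0 ≤ C J) :
    capacityRegion P C = mixedRegion P C i ∧
      closure (compositeRegionWith P C (decodeMixed P)) = capacityRegion P C ∧
      closure (compositeRegion P C) = capacityRegion P C := by
  have h0 : capacityRegion P C ⊆ mixedRegion P C i := fun R hR =>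
    ⟨capacityRegion_subset_maisRegion P C hR, (add_add_eq_sum R i).le.trans
      (sum_le_of_mem_capacityRegion hR hP.1 ((by decide : ∀ i : Fin 3, i + 1 ≠ i + 2) i)
        (eq_or_eq_add_one_or_eq_add_two i))⟩
  have h := closure_compositeRegionWith_eq hC (self_mem_decodeMixed P) fun R hR =>
    mem_closure_of_isMixed hP hC (h0 hR)
  exact ⟨h0.antisymm fun R hR => h.1.subset (mem_closure_of_isMixed hP hC hR), h⟩

/-! ### The table -/

instance {n : ℕ} (P Q : Problem n) : Decidable (P.Isomorphic Q) := by
  unfold Problem.Isomorphic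
  infer_instance

instance (P : Problem 3) (i : Fin 3) : Decidable (P.IsMixed i) := by
  unfold Problem.IsMixed
  infer_instance

theorem exists_isomorphic_mem_table (P : Problem 3) :
    ∃ ρ ∈ table, ∃ Q ∈ ρ.problems, P.Isomorphic Q := by
  have key : ∀ a : Finset (Fin 3), 0 ∉ a → ∀ b : Finset (Fin 3), 1 ∉ b → ∀ c : Finset (Fin 3),
      2 ∉ c → ∃ ρ ∈ table, ∃ Q ∈ ρ.problems, ∃ σ : Equiv.Perm (Fin 3),
        ∀ j i, i ∈ ![a, b, c] j ↔ σ i ∈ Q.A (σ j) := by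
    decide +kernel
  obtain ⟨ρ, hρ, Q, hQ, σ, h⟩ := key _ (P.not_mem 0) _ (P.not_mem 1) _ (P.not_mem 2)
  refine ⟨ρ, hρ, Q, hQ, σ, fun i j => ?_⟩
  rw [← h j i]
  fin_cases j <;> rfl

theorem pairwise_not_isomorphic_table :
    (table.flatMap Row.problems).Pairwise (fun P Q => ¬ P.Isomorphic Q) := by
  decide +kernel

/-- Of the seven servers, the `2 ^ (3 - T.card) - 1` inside the complement of `T` are missed. -/
theorem card_servers_inter : ∀ T : Finset (Fin 3), T.Nonempty →
    (Finset.univ.filter fun J : Server 3 => (J.1 ∩ T).Nonempty).card =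
      if T.card = 1 then 4 else if T.card = 2 then 6 else 7 := by
  decide +kernel

theorem sum_le_of_mem_maisRegion_one {P : Problem 3} {R : Fin 3 → ℝ}
    (hR : R ∈ maisRegion P fun _ => 1) {S : Finset (Fin 3)} (hne : S.Nonempty)
    -- Ranks with values in `Fin 3` suffice and keep acyclicity decidable by enumeration.
    (hS : ∃ f : Fin 3 → Fin 3, ∀ a ∈ S, ∀ b ∈ S, a ∈ P.A b → f a < f b) :
    ∑ j ∈ S, R j ≤ ((if S.card = 1 then 4 else if S.card = 2 then 6 else 7 : ℕ) : ℝ) := by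
  obtain ⟨f, hf⟩ := hS
  have := sum_le_of_mem_maisRegion hR (Problem.acyclicOn_of_rank (fun l => (f l : ℕ)) hf)
  rwa [Finset.sum_const, card_servers_inter S hne, nsmul_one] at this

theorem Problem.not_acyclicOn_univ {n : ℕ} {P : Problem n} {a b c : Fin n} (hab : a ∈ P.A b)
    (hbc : b ∈ P.A c) (hca : c ∈ P.A a) : ¬ P.AcyclicOn Finset.univ :=
  fun h => h a (((Relation.TransGen.single ⟨by simp, by simp, hab⟩).tail
    ⟨by simp, by simp, hbc⟩).tail ⟨by simp, by simp, hca⟩)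

theorem mem_maisRegion_one {P : Problem 3} {R : Fin 3 → ℝ} (h0 : ∀ j, 0 ≤ R j)
    (h1 : ∀ j, R j ≤ 4) (h01 : (0 ∈ P.A 1 ∧ 1 ∈ P.A 0) ∨ R 0 + R 1 ≤ 6)
    (h02 : (0 ∈ P.A 2 ∧ 2 ∈ P.A 0) ∨ R 0 + R 2 ≤ 6) (h12 : (1 ∈ P.A 2 ∧ 2 ∈ P.A 1) ∨ R 1 + R 2 ≤ 6)
    (h012 : ((∃ a b, a ∈ P.A b ∧ b ∈ P.A a) ∨ ∃ a b c, a ∈ P.A b ∧ b ∈ P.A c ∧ c ∈ P.A a) ∨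
      R 0 + R 1 + R 2 ≤ 7) : R ∈ maisRegion P fun _ => 1 := by
  refine ⟨h0, fun T hT S hST hS => ?_⟩
  -- Enlarging `T` only weakens the bound, so `T = S` is the case to check.
  have hsub : ∑ J : Server 3 with (J.1 ∩ S).Nonempty, (1 : ℝ) ≤
      ∑ J : Server 3 with (J.1 ∩ T).Nonempty, (1 : ℝ) := by
    refine Finset.sum_le_sum_of_subset_of_nonneg (fun J hJ => ?_) fun _ _ _ => zero_le_one
    simp only [Finset.mem_filter, Finset.mem_univ, true_and] at hJ ⊢
    exact hJ.mono (Finset.inter_subset_inter_left hST)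
  rcases S.eq_empty_or_nonempty with rfl | hne
  · simp
  refine le_trans ?_ hsub
  rw [Finset.sum_const, card_servers_inter S hne, nsmul_one]
  have hcases : ∀ S : Finset (Fin 3), S.Nonempty → (∃ j, S = {j}) ∨ S = {0, 1} ∨ S = {0, 2} ∨
      S = {1, 2} ∨ S = Finset.univ := by decide +kernel
  rcases hcases S hne with ⟨j, rfl⟩ | rfl | rfl | rfl | rfl
  · simpa using h1 j
  · refine (Finset.sum_pair (by decide)).trans_le ?_
    simpa using h01.resolve_left fun h => Problem.not_acyclicOn (by simp) (by simp) h.1 h.2 hS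
  · refine (Finset.sum_pair (by decide)).trans_le ?_
    simpa using h02.resolve_left fun h => Problem.not_acyclicOn (by simp) (by simp) h.1 h.2 hS
  · refine (Finset.sum_pair (by decide)).trans_le ?_
    simpa using h12.resolve_left fun h => Problem.not_acyclicOn (by simp) (by simp) h.1 h.2 hS
  · rw [Fin.sum_univ_three]
    refine (h012.resolve_left ?_).trans (by simp)
    rintro (⟨a, b, hab, hba⟩ | ⟨a, b, c, hab, hbc, hca⟩)
    exacts [Problem.not_acyclicOn (by simp) (by simp) hab hba hS,
      Problem.not_acyclicOn_univ hab hbc hca hS]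

/-- The bounds in the row `ρ` are those of the MAIS region of `P` for unit link capacities, up to the
bound on the sum rate if `P` has a cycle. -/
def Row.Fits (ρ : Row) (P : Problem 3) : Prop :=
  (ρ.b1 = 4 ∧ ρ.b2 = 4 ∧ ρ.b3 = 4) ∧
  (if 0 ∈ P.A 1 ∧ 1 ∈ P.A 0 then ρ.b12 = 8 else ρ.b12 = 6) ∧
  (if 0 ∈ P.A 2 ∧ 2 ∈ P.A 0 then ρ.b13 = 8 else ρ.b13 = 6) ∧
  (if 1 ∈ P.A 2 ∧ 2 ∈ P.A 1 then ρ.b23 = 8 else ρ.b23 = 6) ∧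
  (((∃ a b, a ∈ P.A b ∧ b ∈ P.A a) ∨ ∃ a b c, a ∈ P.A b ∧ b ∈ P.A c ∧ c ∈ P.A a) ∨ ρ.b123 = 7)

/-- The bound on the sum rate in the row `ρ` follows from the other bounds or the MAIS bound. -/
def Row.SumRedundant (ρ : Row) (P : Problem 3) : Prop :=
  (ρ.b123 = 7 ∧ ∃ f : Fin 3 → Fin 3, ∀ a b, a ∈ P.A b → f a < f b) ∨
  ρ.b12 + ρ.b13 + ρ.b23 ≤ 2 * ρ.b123 ∨ ρ.b12 + ρ.b3 ≤ ρ.b123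

instance (ρ : Row) (P : Problem 3) : Decidable (ρ.Fits P) := by
  unfold Row.Fits
  infer_instance

instance (ρ : Row) (P : Problem 3) : Decidable (ρ.SumRedundant P) := by
  unfold Row.SumRedundant
  infer_instance

theorem fits_of_mem_table : ∀ ρ ∈ table, ∀ P ∈ ρ.problems, ρ.Fits P := by
  decide +kernel

theorem sumRedundant_of_mem : ∀ ρ ∈ [row1, row2, row4, row5, row6], ∀ P ∈ ρ.problems,
    ρ.SumRedundant P ∧ ∀ i, ¬ P.IsMixed i := by
  decide +kernel

theorem isMixed_of_mem_row3 : ∀ P ∈ row3.problems, P.IsMixed 0 := by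
  decide +kernel

theorem le_of_mem_maisRegion_one {P : Problem 3} {R : Fin 3 → ℝ}
    (hR : R ∈ maisRegion P fun _ => 1) (j : Fin 3) : R j ≤ 4 := by
  have := sum_le_of_mem_maisRegion_one hR (S := {j}) (by simp) ⟨fun _ => 0, fun a ha b hb hab => by
    rw [Finset.mem_singleton.1 ha, Finset.mem_singleton.1 hb] at hab
    exact absurd hab (P.not_mem j)⟩
  simpa using this

theorem add_le_of_mem_maisRegion_one {P : Problem 3} {R : Fin 3 → ℝ}
    (hR : R ∈ maisRegion P fun _ => 1) {i j : Fin 3} (hij : i ≠ j) {c : ℕ}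
    (hc : if i ∈ P.A j ∧ j ∈ P.A i then c = 8 else c = 6) : R i + R j ≤ c := by
  split_ifs at hc with h
  -- For a 2-cycle the bound 8 is merely the sum of the two individual bounds 4.
  · subst hc
    have := le_of_mem_maisRegion_one hR i
    have := le_of_mem_maisRegion_one hR j
    norm_num
    linarith
  · have hS : ∃ f : Fin 3 → Fin 3, ∀ a ∈ ({i, j} : Finset (Fin 3)), ∀ b ∈ ({i, j} : Finset _),
        a ∈ P.A b → f a < f b := by
      have hi := P.not_mem i
      have hj := P.not_mem j
      by_cases h' : i ∈ P.A j
      · refine ⟨fun l => if l = i then 0 else 1, ?_⟩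
        simp_all [hij.symm]
      · refine ⟨fun l => if l = j then 0 else 1, ?_⟩
        simp_all
    have := sum_le_of_mem_maisRegion_one hR (S := {i, j}) (by simp) hS
    rw [Finset.sum_pair hij, Finset.card_pair hij] at this
    subst hc
    simpa using this

theorem Row.Fits.region_eq {ρ : Row} {P : Problem 3} (h : ρ.Fits P) :
    ρ.region = maisRegion P (fun _ => 1) ∩ {R | R 0 + R 1 + R 2 ≤ ρ.b123} := by
  obtain ⟨⟨h1, h2, h3⟩, h01, h02, h12, h012⟩ := h
  ext R
  constructor
  · rintro ⟨hR, r1, r2, r3, r12, r13, r23, r123⟩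
    rw [h1] at r1
    rw [h2] at r2
    rw [h3] at r3
    push_cast at r1 r2 r3
    refine ⟨mem_maisRegion_one hR (fun j => ?_) ?_ ?_ ?_ (h012.imp_right fun h => ?_), r123⟩
    · fin_cases j
      exacts [r1, r2, r3]
    · split_ifs at h01 with h
      · exact Or.inl h
      · exact Or.inr (by simpa [h01] using r12)
    · split_ifs at h02 with h
      · exact Or.inl h
      · exact Or.inr (by simpa [h02] using r13)
    · split_ifs at h12 with h
      · exact Or.inl h
      · exact Or.inr (by simpa [h12] using r23)
    · simpa [h] using r123
  · rintro ⟨hR, hsum⟩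
    have := le_of_mem_maisRegion_one hR
    refine ⟨hR.1, ?_, ?_, ?_, add_le_of_mem_maisRegion_one hR (by decide) h01,
      add_le_of_mem_maisRegion_one hR (by decide) h02,
      add_le_of_mem_maisRegion_one hR (by decide) h12, hsum⟩
    · simpa [h1] using this 0
    · simpa [h2] using this 1
    · simpa [h3] using this 2

/-- Row 1 is acyclic. In rows 2, 4 and 6 half the sum of the three pair bounds suffices; in row 5 it
is `R 0 + R 1 ≤ 6` with `R 2 ≤ 4`. -/
theorem Row.Fits.sum_le_of_sumRedundant {ρ : Row} {P : Problem 3} (h : ρ.Fits P)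
    (h' : ρ.SumRedundant P) {R : Fin 3 → ℝ} (hR : R ∈ maisRegion P fun _ => 1) :
    R 0 + R 1 + R 2 ≤ ρ.b123 := by
  obtain ⟨⟨-, -, h3⟩, h01, h02, h12, -⟩ := h
  have r01 := add_le_of_mem_maisRegion_one hR (by decide) h01
  have r02 := add_le_of_mem_maisRegion_one hR (by decide) h02
  have r12 := add_le_of_mem_maisRegion_one hR (by decide) h12
  have r2 := le_of_mem_maisRegion_one hR 2
  rcases h' with ⟨hb, f, hf⟩ | hb | hb
  · have := sum_le_of_mem_maisRegion_one hR (S := Finset.univ) (by simp)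
      ⟨f, fun a _ b _ hab => hf a b hab⟩
    rw [Fin.sum_univ_three] at this
    simpa [hb] using this
  · have := (Nat.cast_le (α := ℝ)).2 hb
    push_cast at this
    linarith
  · have := (Nat.cast_le (α := ℝ)).2 hb
    rw [h3] at this
    push_cast at this
    linarith

theorem exists_mem_region_sum_eq :
    ∀ ρ ∈ table, ∃ R ∈ ρ.region, R 0 + R 1 + R 2 = (ρ.b123 : ℝ) := by
  intro ρ hρ
  simp only [table, List.mem_cons, List.not_mem_nil, or_false] at hρ
  have point : ∀ (ρ : Row) (a b c : ℝ), 0 ≤ a → 0 ≤ b → 0 ≤ c →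
      (a ≤ ρ.b1 ∧ b ≤ ρ.b2 ∧ c ≤ ρ.b3 ∧ a + b ≤ ρ.b12 ∧ a + c ≤ ρ.b13 ∧ b + c ≤ ρ.b23 ∧
        a + b + c ≤ ρ.b123) → a + b + c = ρ.b123 →
      ∃ R ∈ ρ.region, R 0 + R 1 + R 2 = (ρ.b123 : ℝ) := by
    intro ρ a b c ha hb hc h h'
    refine ⟨![a, b, c], ⟨fun j => ?_, h⟩, h'⟩
    fin_cases j <;> assumption
  rcases hρ with rfl | rfl | rfl | rfl | rfl | rfl
  · apply point row1 2 2 3 <;> norm_num [row1]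
  · apply point row2 3 3 3 <;> norm_num [row2]
  · apply point row3 2 3 4 <;> norm_num [row3]
  · apply point row4 2 4 4 <;> norm_num [row4]
  · apply point row5 3 3 4 <;> norm_num [row5]
  · apply point row6 4 4 4 <;> norm_num [row6]

theorem mixedRegion_one (P : Problem 3) :
    mixedRegion P (fun _ => 1) 0 = maisRegion P (fun _ => 1) ∩ {R | R 0 + R 1 + R 2 ≤ 9} := by
  -- Seven servers, of which the two holding both messages 1 and 2 are counted twice.
  have h : ∑ J : Server 3, (1 : ℝ) + ∑ J : Server 3 with 0 + 1 ∈ J.1 ∧ 0 + 2 ∈ J.1, (1 : ℝ) = 9 := by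
    have h1 : (Finset.univ : Finset (Server 3)).card = 7 := by decide +kernel
    have h2 : (Finset.univ.filter fun J : Server 3 => 0 + 1 ∈ J.1 ∧ 0 + 2 ∈ J.1).card = 2 := by
      decide +kernel
    rw [Finset.sum_const, Finset.sum_const, h1, h2]
    norm_num
  rw [mixedRegion, h]
  rfl

/-- Unit link capacities, outside the third row. -/
theorem capacityRegion_one_of_mem {ρ : Row} (hρ : ρ ∈ [row1, row2, row4, row5, row6])
    {P : Problem 3} (hP : P ∈ ρ.problems) :
    capacityRegion P (fun _ => 1) = maisRegion P (fun _ => 1) ∧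
      capacityRegion P (fun _ => 1) = ρ.region ∧ (∀ j, j ∈ ρ.D P j) ∧
      closure (compositeRegionWith P (fun _ => 1) (ρ.D P)) = capacityRegion P (fun _ => 1) := by
  obtain ⟨hred, hmix⟩ := sumRedundant_of_mem ρ hρ P hP
  have hD : ρ.D = decodeAll := by
    simp only [List.mem_cons, List.not_mem_nil, or_false] at hρ
    rcases hρ with rfl | rfl | rfl | rfl | rfl <;> rfl
  have hfits : ρ.Fits P := fits_of_mem_table ρ
    (by simp only [table, List.mem_cons] at hρ ⊢; tauto) P hP
  obtain ⟨h1, h2, -⟩ := capacityRegion_of_not_isMixed hmix (C := fun _ => 1) fun _ => zero_le_one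
  refine ⟨h1, ?_, hD ▸ self_mem_decodeAll P, hD ▸ h2⟩
  rw [h1, hfits.region_eq, Set.inter_eq_left.2]
  exact fun R hR => hfits.sum_le_of_sumRedundant hred hR

/-- Unit link capacities in the third row. -/
theorem capacityRegion_one_of_mem_row3 {P : Problem 3} (hP : P ∈ row3.problems) :
    capacityRegion P (fun _ => 1) = maisRegion P (fun _ => 1) ∩ {R | R 0 + R 1 + R 2 ≤ 9} ∧
      capacityRegion P (fun _ => 1) = row3.region ∧ (∀ j, j ∈ row3.D P j) ∧
      closure (compositeRegionWith P (fun _ => 1) (row3.D P)) = capacityRegion P (fun _ => 1) := by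
  have hfits : row3.Fits P := fits_of_mem_table row3 (by simp [table]) P hP
  obtain ⟨h1, h2, -⟩ :=
    capacityRegion_of_isMixed (isMixed_of_mem_row3 P hP) (C := fun _ => 1) fun _ => zero_le_one
  rw [mixedRegion_one] at h1
  refine ⟨h1, ?_, self_mem_decodeMixed P, h2⟩
  rw [h1, hfits.region_eq]
  norm_num [row3]

theorem capacityRegion_one_ne_maisRegion {P : Problem 3} (hP : P ∈ row3.problems) :
    capacityRegion P (fun _ => 1) ≠ maisRegion P (fun _ => 1) := by
  obtain ⟨-, hjk, hkj⟩ := isMixed_of_mem_row3 P hP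
  intro h
  -- This point has sum 10 and meets all MAIS bounds: both pairs with 0 sum to 6, and the 2-cycle on
  -- 1 and 2 removes the bounds for `{1, 2}` and the full set.
  let R : Fin 3 → ℝ := ![2, 4, 4]
  have h0 : R 0 = 2 := rfl
  have h1 : R 1 = 4 := rfl
  have h2 : R 2 = 4 := rfl
  have hR : R ∈ maisRegion P fun _ => 1 :=
    mem_maisRegion_one (fun j => by fin_cases j <;> norm_num [R])
      (fun j => by fin_cases j <;> norm_num [R]) (Or.inr (by norm_num [h0, h1]))
      (Or.inr (by norm_num [h0, h2])) (Or.inl ⟨hjk, hkj⟩) (Or.inl (Or.inl ⟨1, 2, hjk, hkj⟩))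
  rw [← h, (capacityRegion_one_of_mem_row3 hP).1] at hR
  have h9 : R 0 + R 1 + R 2 ≤ 9 := hR.2
  norm_num [h0, h1, h2] at h9

theorem closure_compositeRegion_eq_capacityRegion (P : Problem 3) {C : Server 3 → ℝ}
    (hC : ∀ J, 0 ≤ C J) : closure (compositeRegion P C) = capacityRegion P C := by
  by_cases h : ∃ i, P.IsMixed i
  · obtain ⟨i, hi⟩ := h
    exact (capacityRegion_of_isMixed hi hC).2.2
  · exact (capacityRegion_of_not_isMixed (not_exists.1 h) hC).2.2

end DistIndexCoding

theorem mainTheorem5 :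
    -- the table lists every 3-message problem, exactly once up to isomorphism
    (∀ P : Problem 3, ∃ ρ ∈ table, ∃ Q ∈ ρ.problems, P.Isomorphic Q) ∧
    (table.flatMap Row.problems).Pairwise (fun P Q => ¬ P.Isomorphic Q) ∧
    -- for unit link capacities the capacity region is the listed one, with the listed maximal sum
    -- rate, and composite coding with the listed decoding sets achieves it
    (∀ ρ ∈ table, ∀ P ∈ ρ.problems,
      capacityRegion P (fun _ => 1) = ρ.region ∧
      IsGreatest ((fun R : Fin 3 → ℝ => R 0 + R 1 + R 2) '' capacityRegion P (fun _ => 1))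
        (ρ.b123 : ℝ) ∧
      (∀ j, j ∈ ρ.D P j) ∧
      closure (compositeRegionWith P (fun _ => 1) (ρ.D P)) = capacityRegion P (fun _ => 1)) ∧
    -- the MAIS bound is tight outside the third row
    (∀ ρ ∈ [row1, row2, row4, row5, row6], ∀ P ∈ ρ.problems,
      capacityRegion P (fun _ => 1) = maisRegion P (fun _ => 1)) ∧
    -- in the third row it is not, but becomes so together with `R₁ + R₂ + R₃ ≤ 9`
    (∀ P ∈ row3.problems,
      capacityRegion P (fun _ => 1) ≠ maisRegion P (fun _ => 1) ∧
      capacityRegion P (fun _ => 1) =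
        maisRegion P (fun _ => 1) ∩ {R | R 0 + R 1 + R 2 ≤ 9}) ∧
    -- composite coding achieves the capacity region of every 3-message problem
    (∀ (P : Problem 3) (C : Server 3 → ℝ), (∀ J, 0 ≤ C J) →
      closure (compositeRegion P C) = capacityRegion P C) := by
  refine ⟨exists_isomorphic_mem_table, pairwise_not_isomorphic_table, ?_,
    fun ρ hρ P hP => (capacityRegion_one_of_mem hρ hP).1,
    fun P hP => ⟨capacityRegion_one_ne_maisRegion hP, (capacityRegion_one_of_mem_row3 hP).1⟩,
    fun P C hC => closure_compositeRegion_eq_capacityRegion P hC⟩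
  intro ρ hρ P hP
  have h : capacityRegion P (fun _ => 1) = ρ.region ∧ (∀ j, j ∈ ρ.D P j) ∧
      closure (compositeRegionWith P (fun _ => 1) (ρ.D P)) = capacityRegion P (fun _ => 1) := by
    by_cases h3 : ρ = row3
    · subst h3
      exact (capacityRegion_one_of_mem_row3 hP).2
    · refine (capacityRegion_one_of_mem ?_ hP).2
      simp only [table, List.mem_cons] at hρ ⊢
      tauto
  refine ⟨h.1, ?_, h.2⟩
  rw [h.1]
  refine ⟨exists_mem_region_sum_eq ρ hρ, ?_⟩
  rintro _ ⟨R, hR, rfl⟩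
  exact hR.2.2.2.2.2.2.2
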